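/- Let $\mathbb L$ be the square, triangular or hexagonal lattice, embedded in $\mathbb R^2$ with edges of length one, with set of sites $V(\mathbb L)$. A configuration is a set $\omega\subset V(\mathbb L)$ of open sites; a cluster of $\omega$ is a connected component of the subgraph of $\mathbb L$ induced by $\omega$. For the square and triangular lattices, fix an origin $o\in V(\mathbb L)$. An enhancement function $\phi_o$ maps configurations to configurations in such a way that, for some $R_0<\infty$ and with $\mathbb B_o=\{y\in V(\mathbb L):|y-o|\le R_0\}$, for every $\omega$ the set $\phi_o(\omega)$ depends only on $\omega\cap\mathbb B_o$ and $\phi_o(\omega)\subset\mathbb B_o$. It is extended by translations to a family $\phi_x(\omega)=x+\phi_o(\omega-x)$, $x\in V(\mathbb L)$ (with $o=0$). For the hexagonal lattice, whose sites form two orbits under the translations of the lattice, one such function is given at a base site $o_i$ of each orbit $i\in\{1,2\}$, and $\phi_{t+o_i}(\omega)=t+\phi_{o_i}(\omega-t)$ for every translation vector $t$ of the lattice. The family $\phi$ is called an enhancement. It is monotonic if $\omega\subset\omega'$ implies $\phi_o(\omega)\subset\phi_o(\omega')$ for each base site $o$. For $\alpha\in\{0,1\}^{V(\mathbb L)}$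 the enhanced configuration is $$\hat\omega(\omega,\alpha)=\omega\cup\bigcup_{x:\,\alpha(x)=1}\phi_x(\omega).$$ A doubly-infinite self-repelling path is a sequence $(\gamma_n)_{n\in\mathbb Z}$ of distinct sites such that $\gamma_m$ and $\gamma_n$ are adjacent in $\mathbb L$ if and only if $|m-n|=1$. The enhancement is essential if, for the origin $o$ (for one of the two base sites $o$, in the hexagonal case), there is a configuration $\omega$ that contains no doubly-infinite self-repelling path while $\omega\cup\phi_o(\omega)$ contains one. **Lemma.** Let $\phi$ be a monotonic enhancement on $\mathbb L$. Then $\phi$ is essential if and only if there are a configuration $\omega$ that contains no infinite cluster and an $\alpha\in\{0,1\}^{V(\mathbb L)}$ such that $\hat\omega(\omega,\alpha)$ contains an infinite cluster. In particular, if $\phi$ is not essential, then for every $\omega$ without an infinite cluster and every $\alpha$, the enhanced configuration $\hat\omega(\omega,\alpha)$ contains no infinite cluster. -/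

import Mathlib

/-- The square, the triangular and the hexagonal lattice. -/
inductive PlanarLattice : Type
  | square
  | triangular
  | hexagonal

namespace PlanarLattice

/-- The sites of each lattice are described as `(t, i)`, with `t` a translation in `ℤ × ℤ` and `i` the
orbit of the site under the translations of the lattice: one orbit for the square and triangular
lattices, two for the hexagonal lattice. -/
def Orbit : PlanarLattice → Type
  | square => Unit
  | triangular => Unit
  | hexagonal => Bool

/-- The set of sites `V(𝕃)`. -/
abbrev Site (L : PlanarLattice) : Type := (ℤ × ℤ) × L.Orbit

/-- The embedding of the sites in the plane `ℝ² = ℂ`; all edges have length one. -/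
noncomputable def pos : (L : PlanarLattice) → L.Site → ℂ
  | square, ((m, n), _) => (m : ℂ) + (n : ℂ) * Complex.I
  | triangular, ((m, n), _) => (m : ℂ) + (n : ℂ) * (1 / 2 + (Real.sqrt 3 / 2 : ℝ) * Complex.I)
  | hexagonal, ((m, n), false) =>
      (Real.sqrt 3 : ℂ) * ((m : ℂ) + (n : ℂ) * (1 / 2 + (Real.sqrt 3 / 2 : ℝ) * Complex.I))
  | hexagonal, ((m, n), true) =>
      (Real.sqrt 3 : ℂ) * ((m : ℂ) + (n : ℂ) * (1 / 2 + (Real.sqrt 3 / 2 : ℝ) * Complex.I))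
        + ((Real.sqrt 3 / 2 : ℝ) + 1 / 2 * Complex.I)

/-- The edges of the lattice, each listed in one of its two directions. -/
def Edge : (L : PlanarLattice) → L.Site → L.Site → Prop
  | square, (s, _), (t, _) => t - s ∈ ({(1, 0), (0, 1)} : Set (ℤ × ℤ))
  | triangular, (s, _), (t, _) => t - s ∈ ({(1, 0), (0, 1), (1, -1)} : Set (ℤ × ℤ))
  | hexagonal, (s, a), (t, b) =>
      a = false ∧ b = true ∧ t - s ∈ ({(0, 0), (-1, 0), (0, -1)} : Set (ℤ × ℤ))

/-- The lattice as a graph on its sites. -/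
def graph (L : PlanarLattice) : SimpleGraph L.Site := SimpleGraph.fromRel L.Edge

/-- The base site of an orbit. For the square and triangular lattices this is the origin `o`. -/
def base (L : PlanarLattice) (i : L.Orbit) : L.Site := (0, i)

/-- The translate of the site `y` by `t`. -/
def translate (L : PlanarLattice) (t : ℤ × ℤ) (y : L.Site) : L.Site := (t + y.1, y.2)

/-- A configuration, given by its set of open sites. -/
abbrev Config (L : PlanarLattice) : Type := Set L.Site

/-- The shift `τ_t` on configurations: `y` is open in `τ_t ω` iff `y + t` is open in `ω`. -/
def shift (L : PlanarLattice) (t : ℤ × ℤ) (ω : L.Config) : L.Config := {y | L.translate t y ∈ ω}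

/-- The sites in the closed Euclidean ball of radius `R` about the site `x`. -/
def ball (L : PlanarLattice) (x : L.Site) (R : ℝ) : Set L.Site := {y | ‖L.pos y - L.pos x‖ ≤ R}

/-- `ω` contains an infinite (open) cluster. -/
def HasInfiniteCluster (L : PlanarLattice) (ω : L.Config) : Prop :=
  ∃ C : (L.graph.induce ω).ConnectedComponent, C.supp.Infinite

/-- `γ` is a doubly-infinite self-repelling path. -/
structure IsDoublyInfiniteSelfRepellingPath (L : PlanarLattice) (γ : ℤ → L.Site) : Prop where
  injective : Function.Injective γ
  adj_succ : ∀ n, L.graph.Adj (γ n) (γ (n + 1))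
  repelling : ∀ m n, L.graph.Adj (γ m) (γ n) → n = m + 1 ∨ m = n + 1

/-- `ω` contains a doubly-infinite self-repelling path. -/
def ContainsDoublyInfiniteSelfRepellingPath (L : PlanarLattice) (ω : L.Config) : Prop :=
  ∃ γ : ℤ → L.Site, L.IsDoublyInfiniteSelfRepellingPath γ ∧ ∀ n, γ n ∈ ω

end PlanarLattice

/-- An enhancement, given by an enhancement function at the base site of each orbit of sites. On the
square and triangular lattices this is a single enhancement function `φ_o` at the origin. -/
structure Enhancement (L : PlanarLattice) where
  /-- The enhancement functions at the base sites. -/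
  baseFun : L.Orbit → L.Config → L.Config
  /-- Locality, with enhancement range `R₀`. -/
  local_range : ∃ R₀ : ℝ, ∀ i : L.Orbit,
    (∀ ω ω' : L.Config, ω ∩ L.ball (L.base i) R₀ = ω' ∩ L.ball (L.base i) R₀ →
      baseFun i ω = baseFun i ω') ∧
    ∀ ω : L.Config, baseFun i ω ⊆ L.ball (L.base i) R₀

namespace Enhancement

variable {L : PlanarLattice}

/-- The extension by translations: `φ_x(ω) = x + φ_o(τ_x ω)`. -/
def atSite (φ : Enhancement L) (x : L.Site) (ω : L.Config) : L.Config :=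
  L.translate x.1 '' φ.baseFun x.2 (L.shift x.1 ω)

/-- The enhanced configuration; the enhancement is activated at the sites `x` with `α x = true`. -/
def enhanced (φ : Enhancement L) (ω : L.Config) (α : L.Site → Bool) : L.Config :=
  ω ∪ ⋃ x ∈ {x : L.Site | α x = true}, φ.atSite x ω

/-- Monotonic enhancements. -/
def Monotonic (φ : Enhancement L) : Prop :=
  ∀ (i : L.Orbit) (ω ω' : L.Config), ω ⊆ ω' → φ.baseFun i ω ⊆ φ.baseFun i ω'

/-- Essential enhancements: some configuration contains no doubly-infinite self-repelling path, but
the enhancement at the origin (at a base site) produces such a path. -/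
def Essential (φ : Enhancement L) : Prop :=
  ∃ (i : L.Orbit) (ω : L.Config),
    ¬ L.ContainsDoublyInfiniteSelfRepellingPath ω ∧
    L.ContainsDoublyInfiniteSelfRepellingPath (ω ∪ φ.baseFun i ω)

/-- Some configuration without an infinite cluster has an enhanced configuration that contains an
infinite cluster. -/
def CanCreateInfiniteCluster (φ : Enhancement L) : Prop :=
  ∃ ω : L.Config, ¬ L.HasInfiniteCluster ω ∧
    ∃ α : L.Site → Bool, L.HasInfiniteCluster (φ.enhanced ω α)

end Enhancement

/-! Both properties are equivalent to a local one, `HasGadget`: inside a box containing the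
enhancement range there is a configuration `ζ` that fails to join two non-adjacent exits `p`, `q` of
the box, but joins them once the enhancement at the base site is applied.

From an essential enhancement (`hasGadget_of_essential`): keep only the part of the configuration
inside the box or on the created path. The two ends of the path are joined after enhancement. Were
they joined before, a shortest connection between them together with the two tails would already be
a doubly-infinite self-repelling path (`containsPath_of_joined_ends`). So the enhancement joins two
previously separate sites outside the box, and some passage through the box is a gadget
(`hasGadget_of_joined`).

From a created infinite cluster (`hasGadget_of_canCreate`): without gadgets, an activation at `x`
never joins two sites outside the box about `x`. Fix a site `v`. The finitely many activations near
`v` leave its cluster finite. Add the others one by one; if one of them let the cluster reach far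
out, then opening everything far away would turn this into a forbidden connection between `v` and a
distant site. Monotonicity enters here, to compare activations in growing configurations.

Conversely, a gadget gives both properties (`essential_and_canCreate_of_routing`). Attach arms to
`p` and `q` so that translates of box and arms form a chain in which consecutive links touch in
exactly one edge (`exists_routing`). A chain of enhanced links contains a doubly-infinite path. If
only the zeroth link is unenhanced, there is no such path; if no link is enhanced, all clusters are
finite. The routing is planar geometry on the cells `ℤ × ℤ`, common to the three lattices. -/

namespace SimpleGraph

/-! ### Paths inside a set of vertices -/

variable {V : Type*}

/-- The edges of `G` with both endpoints in `S`, as a graph on all vertices. -/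
def openGraph (G : SimpleGraph V) (S : Set V) : SimpleGraph V where
  Adj a b := G.Adj a b ∧ a ∈ S ∧ b ∈ S
  symm := ⟨fun _ _ h => ⟨h.1.symm, h.2.2, h.2.1⟩⟩
  loopless := ⟨fun _ h => h.1.ne rfl⟩

/-- `a` and `b` are joined by a path of `G` in `S` (or are equal). -/
abbrev Joined (G : SimpleGraph V) (S : Set V) (a b : V) : Prop := (G.openGraph S).Reachable a b

variable {G : SimpleGraph V} {S S' : Set V} {a b c : V}

theorem Joined.of_adj (h : G.Adj a b) (ha : a ∈ S) (hb : b ∈ S) : G.Joined S a b :=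
  Adj.reachable (G := G.openGraph S) ⟨h, ha, hb⟩

theorem Joined.induction {P : V → Prop} (h : G.Joined S a b) (h0 : P a)
    (step : ∀ y z, P y → G.Adj y z → y ∈ S → z ∈ S → P z) : P b := by
  rw [Joined, reachable_iff_reflTransGen] at h
  induction h with
  | refl => exact h0
  | tail _ h2 ih => exact step _ _ ih h2.1 h2.2.1 h2.2.2

theorem Joined.mono (hS : S ⊆ S') (h : G.Joined S a b) : G.Joined S' a b := by
  have key : G.openGraph S ≤ G.openGraph S' := fun _ _ h => ⟨h.1, hS h.2.1, hS h.2.2⟩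
  exact Reachable.mono key h

theorem Joined.mem (h : G.Joined S a b) (ha : a ∈ S) : b ∈ S :=
  h.induction (P := (· ∈ S)) ha fun _ _ _ _ _ h => h

theorem Joined.map {W : Type*} {H : SimpleGraph W} {T : Set W} (f : V → W)
    (hf : ∀ y z, G.Adj y z → y ∈ S → z ∈ S → H.Joined T (f y) (f z)) (h : G.Joined S a b) :
    H.Joined T (f a) (f b) :=
  h.induction (P := fun y => H.Joined T (f a) (f y)) (Reachable.refl _)
    fun y z hy hyz h1 h2 => hy.trans (hf y z hyz h1 h2)

/-- Shortest paths in `S` are self-repelling. -/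
theorem Joined.exists_geodesic (h : G.Joined S a b) (ha : a ∈ S) :
    ∃ (d : ℕ) (f : ℕ → V), f 0 = a ∧ f d = b ∧ (∀ i, f i ∈ S) ∧
      (∀ i < d, G.Adj (f i) (f (i + 1))) ∧
      (∀ i ≤ d, ∀ j ≤ d, f i = f j → i = j) ∧
      (∀ i ≤ d, ∀ j ≤ d, G.Adj (f i) (f j) → j = i + 1 ∨ i = j + 1) := by
  obtain ⟨w, hw⟩ := Reachable.exists_walk_length_eq_dist h
  have hmem : ∀ i, w.getVert i ∈ S := fun i =>
    Joined.mem (⟨w.take i⟩ : G.Joined S a _) ha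
  -- Initial segments of a shortest path are shortest, so the index is the distance from `a`. This
  -- gives injectivity at once, and an edge between two vertices changes the distance by at most
  -- one.
  have hd : ∀ i ≤ w.length, (G.openGraph S).dist a (w.getVert i) = i := by
    intro i hi
    apply le_antisymm
    · have := dist_le (w.take i)
      rw [Walk.take_length] at this
      omega
    · have h1 := dist_le (w.drop i)
      rw [Walk.drop_length] at h1
      have h2 := dist_le (w.take i)
      obtain ⟨w1, hw1⟩ := Reachable.exists_walk_length_eq_dist (⟨w.take i⟩ : (G.openGraph S).Reachable _ _)
      have h3 := dist_le (w1.append (w.drop i))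
      rw [Walk.length_append, Walk.drop_length] at h3
      omega
  refine ⟨w.length, w.getVert, by simp, by simp, hmem, fun i hi => (w.adj_getVert_succ hi).1,
    fun i hi j hj hij => ?_, fun i hi j hj hij => ?_⟩
  · rw [← hd i hi, ← hd j hj, hij]
  · have key : ∀ i ≤ w.length, ∀ j ≤ w.length, G.Adj (w.getVert i) (w.getVert j) → j ≤ i + 1 := by
      intro i hi j hj hij
      have hij' : (G.openGraph S).Adj (w.getVert i) (w.getVert j) := ⟨hij, hmem i, hmem j⟩
      obtain ⟨w1, hw1⟩ := Reachable.exists_walk_length_eq_dist (⟨w.take i⟩ : (G.openGraph S).Reachable _ _)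
      have h3 := dist_le (w1.concat hij')
      rw [Walk.length_concat, hw1, hd i hi, hd j hj] at h3
      exact h3
    have h1 := key i hi j hj hij
    have h2 := key j hj i hi hij.symm
    have h3 : i ≠ j := by
      rintro rfl
      exact hij.ne rfl
    omega

/-- A set of vertices that is closed under adjacency in `S` contains the clusters of its members. -/
theorem Joined.mem_of_closed {U : Set V} (h : G.Joined S a b) (ha : a ∈ U)
    (hU : ∀ y z, y ∈ U → G.Adj y z → y ∈ S → z ∈ S → z ∈ U) : b ∈ U :=
  h.induction (P := (· ∈ U)) ha hU

/-- Opening finitely many vertices keeps clusters finite. -/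
theorem Joined.finite_union (hG : ∀ v, {u | G.Adj v u}.Finite)
    (hS : ∀ v ∈ S, {u | G.Joined S v u}.Finite) {E : Set V} (hE : E.Finite) (v : V) :
    {u | G.Joined (S ∪ E) v u}.Finite := by
  -- The new cluster is covered by `X` and the old clusters of the finitely many vertices of `S` in
  -- or next to `X`.
  set X : Set V := insert v E with hX
  set Y : Set V := X ∪ ⋃ x ∈ X, {u | G.Adj x u} with hY
  have hXf : X.Finite := hE.insert v
  have hYf : Y.Finite := hXf.union (hXf.biUnion fun x _ => hG x)
  have hZ : (X ∪ ⋃ y ∈ Y ∩ S, {u | G.Joined S y u}).Finite :=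
    hXf.union ((hYf.inter_of_left S).biUnion fun y hy => hS y hy.2)
  refine hZ.subset fun u hu => ?_
  refine Joined.mem_of_closed hu (Or.inl (Or.inl rfl)) fun y z hy hyz hyS hzS => ?_
  rcases hzS with hzS | hzE
  · right
    simp only [Set.mem_iUnion]
    rcases hy with hy | hy
    · exact ⟨z, ⟨Or.inr (Set.mem_biUnion hy hyz), hzS⟩, Reachable.refl _⟩
    · simp only [Set.mem_iUnion] at hy
      obtain ⟨x, hx, hxy⟩ := hy
      exact ⟨x, hx, Reachable.trans hxy (Joined.of_adj hyz (Joined.mem hxy hx.2) hzS)⟩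
  · exact Or.inl (Or.inr hzE)

end SimpleGraph

/-! ### Infinite clusters and doubly-infinite paths -/

namespace PlanarLattice

variable {L : PlanarLattice}

/-- Replaces components of an induced subgraph by a relation on all sites, so that the configuration
can vary while the vertex type stays fixed. -/
theorem hasInfiniteCluster_iff (ω : L.Config) :
    L.HasInfiniteCluster ω ↔ ∃ v ∈ ω, {u | L.graph.Joined ω v u}.Infinite := by
  have key : ∀ a : ω, (fun b : ω => (b : L.Site)) '' ((L.graph.induce ω).connectedComponentMk a).supp =
      {u | L.graph.Joined ω a u} := by
    intro a
    ext u
    simp only [Set.mem_image, SimpleGraph.ConnectedComponent.mem_supp_iff,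
      SimpleGraph.ConnectedComponent.eq, Set.mem_ofPred_eq]
    constructor
    · rintro ⟨b, hb, rfl⟩
      exact hb.symm.map (⟨Subtype.val, fun {x y} h => ⟨h, x.2, y.2⟩⟩ :
        L.graph.induce ω →g L.graph.openGraph ω)
    · intro h
      obtain ⟨hu, h⟩ := SimpleGraph.Joined.induction
        (P := fun y => ∃ hy : y ∈ ω, (L.graph.induce ω).Reachable a ⟨y, hy⟩) h
        ⟨a.2, SimpleGraph.Reachable.refl _⟩ fun y z hy hyz _ hz =>
          ⟨hz, hy.2.trans (SimpleGraph.Adj.reachable (by simpa using hyz))⟩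
      exact ⟨⟨u, hu⟩, h.symm, rfl⟩
  constructor
  · rintro ⟨C, hC⟩
    induction C using SimpleGraph.ConnectedComponent.ind with
    | h a =>
      refine ⟨a, a.2, ?_⟩
      rw [← key a]
      exact hC.image Subtype.val_injective.injOn
  · rintro ⟨v, hv, h⟩
    refine ⟨(L.graph.induce ω).connectedComponentMk ⟨v, hv⟩, ?_⟩
    rw [← key ⟨v, hv⟩] at h
    exact h.of_image _

theorem HasInfiniteCluster.mono {ω ω' : L.Config} (h : ω ⊆ ω') (hω : L.HasInfiniteCluster ω) :
    L.HasInfiniteCluster ω' := by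
  rw [hasInfiniteCluster_iff] at *
  obtain ⟨v, hv, hi⟩ := hω
  exact ⟨v, h hv, hi.mono fun u hu => SimpleGraph.Joined.mono h hu⟩

theorem joined_of_path {γ : ℤ → L.Site} {ω : L.Config} (hγ : ∀ n, L.graph.Adj (γ n) (γ (n + 1)))
    {a b : ℤ} (hab : a ≤ b) (hω : ∀ n, a ≤ n → n ≤ b → γ n ∈ ω) :
    L.graph.Joined ω (γ a) (γ b) := by
  induction b, hab using Int.leInduction with
  | base => exact SimpleGraph.Reachable.refl _
  | succ n hn ih =>
    exact (ih fun m h1 h2 => hω m h1 (by omega)).trans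
      (SimpleGraph.Joined.of_adj (hγ n) (hω n hn (by omega)) (hω _ (by omega) le_rfl))

theorem ContainsDoublyInfiniteSelfRepellingPath.hasInfiniteCluster {ω : L.Config}
    (h : L.ContainsDoublyInfiniteSelfRepellingPath ω) : L.HasInfiniteCluster ω := by
  obtain ⟨γ, hγ, hω⟩ := h
  rw [hasInfiniteCluster_iff]
  refine ⟨γ 0, hω 0, (Set.infinite_range_of_injective
    (hγ.injective.comp Nat.cast_injective)).mono ?_⟩
  rintro _ ⟨n, rfl⟩
  exact joined_of_path hγ.adj_succ (by simp) fun m _ _ => hω m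

theorem ContainsDoublyInfiniteSelfRepellingPath.mono {ω ω' : L.Config} (h : ω ⊆ ω')
    (hω : L.ContainsDoublyInfiniteSelfRepellingPath ω) :
    L.ContainsDoublyInfiniteSelfRepellingPath ω' := by
  obtain ⟨γ, hγ, hn⟩ := hω
  exact ⟨γ, hγ, fun n => h (hn n)⟩

end PlanarLattice

/-! ### Cells: a common frame for the three lattices -/

namespace PlanarLattice

variable {L : PlanarLattice}

/-- Adjacency or equality of cells in the triangular lattice. -/
def Near (c d : ℤ × ℤ) : Prop :=
  -1 ≤ d.1 - c.1 ∧ d.1 - c.1 ≤ 1 ∧ -1 ≤ d.2 - c.2 ∧ d.2 - c.2 ≤ 1 ∧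
    -1 ≤ (d.1 - c.1) + (d.2 - c.2) ∧ (d.1 - c.1) + (d.2 - c.2) ≤ 1

/-- The unit steps between cells. -/
def IsStep (s : ℤ × ℤ) : Prop := s = (1, 0) ∨ s = (0, 1) ∨ s = (-1, 0) ∨ s = (0, -1)

/-- The square lattice on the cells. -/
def cellGraph : SimpleGraph (ℤ × ℤ) where
  Adj c d := IsStep (d - c)
  symm := ⟨fun c d h => by
    obtain ⟨a, b⟩ := c
    obtain ⟨a', b'⟩ := d
    simp only [IsStep, Prod.mk_sub_mk, Prod.mk.injEq] at h ⊢
    omega⟩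
  loopless := ⟨fun c h => by simp [IsStep, Prod.ext_iff] at h⟩

theorem site_ext {x y x' y' : ℤ} {a : L.Orbit} :
    (((x, y), a) : L.Site) = ((x', y'), a) ↔ x = x' ∧ y = y' := by
  simp

theorem graph_adj_square {s t : ℤ × ℤ} {a b : square.Orbit} :
    square.graph.Adj (s, a) (t, b) ↔ IsStep (t - s) := by
  obtain ⟨x, y⟩ := s
  obtain ⟨x', y'⟩ := t
  cases a
  cases b
  simp only [graph, SimpleGraph.fromRel_adj, Edge, IsStep, Set.mem_insert_iff,
    Set.mem_singleton_iff, Prod.mk_sub_mk, Prod.mk.injEq, ne_eq]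
  refine (and_congr_left' (not_congr (site_ext (L := square)))).trans ?_
  omega

theorem graph_adj_triangular {s t : ℤ × ℤ} {a b : triangular.Orbit} :
    triangular.graph.Adj (s, a) (t, b) ↔ IsStep (t - s) ∨ t - s = (1, -1) ∨ t - s = (-1, 1) := by
  obtain ⟨x, y⟩ := s
  obtain ⟨x', y'⟩ := t
  cases a
  cases b
  simp only [graph, SimpleGraph.fromRel_adj, Edge, IsStep, Set.mem_insert_iff,
    Set.mem_singleton_iff, Prod.mk_sub_mk, Prod.mk.injEq, ne_eq]
  refine (and_congr_left' (not_congr (site_ext (L := triangular)))).trans ?_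
  omega

theorem graph_adj_hexagonal {s t : ℤ × ℤ} {a b : Bool} :
    hexagonal.graph.Adj (s, a) (t, b) ↔
      (a = false ∧ b = true ∧ (t - s = (0, 0) ∨ t - s = (-1, 0) ∨ t - s = (0, -1))) ∨
      (a = true ∧ b = false ∧ (t - s = (0, 0) ∨ t - s = (1, 0) ∨ t - s = (0, 1))) := by
  obtain ⟨x, y⟩ := s
  obtain ⟨x', y'⟩ := t
  rw [graph, SimpleGraph.fromRel_adj]
  change ((x, y), a) ≠ ((x', y'), b) ∧ _ ↔ _
  simp only [Edge, Set.mem_insert_iff,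
    Set.mem_singleton_iff, Prod.mk_sub_mk, Prod.mk.injEq, ne_eq]
  cases a <;> cases b <;> simp
  · exact ⟨fun h => by have := h.2.2; omega, fun h => ⟨rfl, rfl, by omega⟩⟩
  · exact ⟨fun h => by have := h.2.2; omega, fun h => ⟨rfl, rfl, by omega⟩⟩

instance : Finite L.Orbit := by
  cases L
  · exact inferInstanceAs (Finite Unit)
  · exact inferInstanceAs (Finite Unit)
  · exact inferInstanceAs (Finite Bool)

theorem near_of_adj {x y : L.Site} (h : L.graph.Adj x y) : Near x.1 y.1 := by
  obtain ⟨⟨a, b⟩, i⟩ := x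
  obtain ⟨⟨a', b'⟩, j⟩ := y
  cases L
  · rw [graph_adj_square] at h
    simp only [IsStep, Near, Prod.mk_sub_mk, Prod.mk.injEq] at h ⊢
    omega
  · rw [graph_adj_triangular] at h
    simp only [IsStep, Near, Prod.mk_sub_mk, Prod.mk.injEq] at h ⊢
    omega
  · have h := graph_adj_hexagonal.1 h
    simp only [Near, Prod.mk_sub_mk, Prod.mk.injEq] at h ⊢
    omega

theorem eq_or_adj_of_cell_eq {x y : L.Site} (h : x.1 = y.1) : x = y ∨ L.graph.Adj x y := by
  obtain ⟨c, i⟩ := x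
  obtain ⟨d, j⟩ := y
  obtain rfl : c = d := h
  cases L
  · cases i
    cases j
    exact Or.inl rfl
  · cases i
    cases j
    exact Or.inl rfl
  · have := @graph_adj_hexagonal c c i j
    change Bool at i j
    cases i <;> cases j <;> first | exact Or.inl rfl | exact Or.inr (this.2 (by simp [Prod.ext_iff]))

/-- Between neighbouring cells there is exactly one edge of the lattice. -/
theorem exists_unique_edge {c d : ℤ × ℤ} (h : IsStep (d - c)) :
    ∃ x y : L.Site, x.1 = c ∧ y.1 = d ∧ L.graph.Adj x y ∧
      ∀ x' y' : L.Site, x'.1 = c → y'.1 = d → L.graph.Adj x' y' → x' = x ∧ y' = y := by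
  cases L
  · refine ⟨(c, ()), (d, ()), rfl, rfl, graph_adj_square.2 h, ?_⟩
    rintro ⟨c', i⟩ ⟨d', j⟩ rfl rfl -
    exact ⟨rfl, rfl⟩
  · refine ⟨(c, ()), (d, ()), rfl, rfl, graph_adj_triangular.2 (Or.inl h), ?_⟩
    rintro ⟨c', i⟩ ⟨d', j⟩ rfl rfl -
    exact ⟨rfl, rfl⟩
  -- In the hexagonal lattice the direction of the step determines the orbit of the starting point:
  -- steps right or up start at `true`, steps left or down at `false`.
  · have key : ∃ a : Bool, (a = false ↔ (d - c = (-1, 0) ∨ d - c = (0, -1))) ∧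
        (a = true ↔ (d - c = (1, 0) ∨ d - c = (0, 1))) := by
      rcases h with h | h | h | h
      · exact ⟨true, by simp [h]⟩
      · exact ⟨true, by simp [h]⟩
      · exact ⟨false, by simp [h]⟩
      · exact ⟨false, by simp [h]⟩
    obtain ⟨a, ha, ha'⟩ := key
    refine ⟨(c, a), (d, !a), rfl, rfl, graph_adj_hexagonal.2 ?_, ?_⟩
    · cases a
      · exact Or.inl ⟨rfl, rfl, Or.inr (ha.1 rfl)⟩
      · exact Or.inr ⟨rfl, rfl, Or.inr (ha'.1 rfl)⟩
    · rintro ⟨c', i⟩ ⟨d', j⟩ rfl rfl hadj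
      have hadj := graph_adj_hexagonal.1 hadj
      have h0 : d' - c' ≠ (0, 0) := by
        intro h0
        simp [IsStep, h0] at h
      rcases hadj with ⟨hi, hj, h1⟩ | ⟨hi, hj, h1⟩
      · have := ha.2 (h1.resolve_left h0)
        subst this
        exact ⟨Prod.ext rfl hi, Prod.ext rfl hj⟩
      · have := ha'.2 (h1.resolve_left h0)
        subst this
        exact ⟨Prod.ext rfl hi, Prod.ext rfl hj⟩

@[simp] theorem translate_fst (t : ℤ × ℤ) (x : L.Site) : (L.translate t x).1 = t + x.1 := rfl

@[simp] theorem translate_translate (s t : ℤ × ℤ) (x : L.Site) :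
    L.translate s (L.translate t x) = L.translate (s + t) x := by
  simp [translate, add_assoc]

@[simp] theorem translate_zero (x : L.Site) : L.translate 0 x = x := by
  simp [translate]

theorem translate_injective (t : ℤ × ℤ) : Function.Injective (L.translate t) := fun x y h => by
  simpa using congrArg (L.translate (-t)) h

@[simp] theorem translate_adj (t : ℤ × ℤ) (x y : L.Site) :
    L.graph.Adj (L.translate t x) (L.translate t y) ↔ L.graph.Adj x y := by
  obtain ⟨c, i⟩ := x
  obtain ⟨d, j⟩ := y
  cases L
  · simp [translate, graph_adj_square]
  · simp [translate, graph_adj_triangular]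
  · have h1 := @graph_adj_hexagonal c d i j
    have h2 := @graph_adj_hexagonal (t + c) (t + d) i j
    rw [add_sub_add_left_eq_sub] at h2
    exact h2.trans h1.symm

theorem translate_adj_left (t : ℤ × ℤ) (x y : L.Site) :
    L.graph.Adj (L.translate t x) y ↔ L.graph.Adj x (L.translate (-t) y) := by
  rw [← translate_adj (-t)]
  simp

/-- The sites over a set of cells. -/
def cellSites (L : PlanarLattice) (S : Set (ℤ × ℤ)) : Set L.Site := {x | x.1 ∈ S}

theorem finite_cellSites {S : Set (ℤ × ℤ)} (hS : S.Finite) : (L.cellSites S).Finite :=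
  (hS.prod (Set.finite_univ (α := L.Orbit))).subset fun _ hx => ⟨hx, trivial⟩

/-- The cells at distance at most `N` from the origin. -/
def cellBox (N : ℤ) : Set (ℤ × ℤ) := {c | -N ≤ c.1 ∧ c.1 ≤ N ∧ -N ≤ c.2 ∧ c.2 ≤ N}

/-- The sites over the cells at distance at most `N` from the origin. -/
def siteBox (L : PlanarLattice) (N : ℤ) : Set L.Site := L.cellSites (cellBox N)

theorem finite_cellBox (N : ℤ) : (cellBox N).Finite :=
  ((Set.finite_Icc (-N) N).prod (Set.finite_Icc (-N) N)).subset
    fun _ hc => ⟨⟨hc.1, hc.2.1⟩, hc.2.2.1, hc.2.2.2⟩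

theorem finite_siteBox (N : ℤ) : (L.siteBox N).Finite := finite_cellSites (finite_cellBox N)

theorem exists_subset_siteBox {S : Set L.Site} (hS : S.Finite) : ∃ N : ℕ, S ⊆ L.siteBox N := by
  induction S, hS using Set.Finite.induction_on with
  | empty => exact ⟨0, Set.empty_subset _⟩
  | @insert x s _ _ ih =>
    obtain ⟨N, hN⟩ := ih
    refine ⟨N + x.1.1.natAbs + x.1.2.natAbs, ?_⟩
    rintro y (rfl | hy)
    · simp only [siteBox, cellSites, cellBox, Set.mem_ofPred_eq]
      omega
    · have := hN hy
      simp only [siteBox, cellSites, cellBox, Set.mem_ofPred_eq] at this ⊢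
      omega

theorem finite_setOf_adj (x : L.Site) : {y | L.graph.Adj x y}.Finite := by
  refine (finite_siteBox (L := L) (x.1.1.natAbs + x.1.2.natAbs + 1)).subset fun y hy => ?_
  have := near_of_adj hy
  simp only [siteBox, cellSites, cellBox, Near, Set.mem_ofPred_eq] at this ⊢
  omega

/-- Paths of cells yield paths of sites. -/
theorem joined_cellSites {S : Set (ℤ × ℤ)} {x y : L.Site} (hx : x.1 ∈ S)
    (h : cellGraph.Joined S x.1 y.1) : L.graph.Joined (L.cellSites S) x y := by
  have same : ∀ x y : L.Site, x.1 ∈ S → x.1 = y.1 → L.graph.Joined (L.cellSites S) x y := by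
    intro x y hx hxy
    rcases eq_or_adj_of_cell_eq hxy with rfl | h
    · exact SimpleGraph.Reachable.refl _
    · exact SimpleGraph.Joined.of_adj h hx (show y.1 ∈ S from hxy ▸ hx)
  have key : ∀ z : L.Site, z.1 = y.1 → L.graph.Joined (L.cellSites S) x z := by
    refine SimpleGraph.Joined.induction
      (P := fun c => ∀ z : L.Site, z.1 = c → L.graph.Joined (L.cellSites S) x z) h ?_ ?_
    · intro z hz
      exact same x z hx hz.symm
    · intro c d hc hcd hcS hdS z hz
      obtain ⟨u, v, rfl, rfl, huv, -⟩ := exists_unique_edge (L := L) (c := c) (d := d) hcd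
      exact ((hc u rfl).trans (SimpleGraph.Joined.of_adj huv hcS hdS)).trans
        (same v z hdS hz.symm)
  exact key y rfl

theorem exists_ball_subset_siteBox (R : ℝ) : ∃ N : ℕ, ∀ i, L.ball (L.base i) R ⊆ L.siteBox N := by
  have h3 : (1 : ℝ) ≤ Real.sqrt 3 := by
    rw [Real.one_le_sqrt]; norm_num
  have sq3 : Real.sqrt 3 * Real.sqrt 3 = 3 := Real.mul_self_sqrt (by norm_num)
  -- A crude bound that serves all three embeddings, including the offset between the two hexagonal
  -- orbits.
  obtain ⟨N, hN⟩ := exists_nat_ge (2 * |R| + 3)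
  have hR := le_abs_self R
  refine ⟨N, fun i y hy => ?_⟩
  have hre : |(L.pos y).re - (L.pos (L.base i)).re| ≤ |R| :=
    ((Complex.abs_re_le_norm (L.pos y - L.pos (L.base i))).trans hy).trans hR
  have him : |(L.pos y).im - (L.pos (L.base i)).im| ≤ |R| :=
    ((Complex.abs_im_le_norm (L.pos y - L.pos (L.base i))).trans hy).trans hR
  have hR0 := abs_nonneg R
  have key : ∀ m n : ℤ, |(n : ℝ)| ≤ |R| * 2 + 1 → |(m : ℝ)| ≤ |R| * 2 + 3 →
      -(N : ℤ) ≤ m ∧ m ≤ N ∧ -(N : ℤ) ≤ n ∧ n ≤ N := by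
    intro m n hn hm
    rw [abs_le] at hn hm
    refine ⟨?_, ?_, ?_, ?_⟩ <;> (rify; linarith)
  obtain ⟨⟨m, n⟩, j⟩ := y
  rw [abs_le] at hre him
  cases L
  · simp [pos, base] at hre him
    refine key m n (abs_le.2 ?_) (abs_le.2 ?_) <;> constructor <;> linarith
  · simp [pos, base] at hre him
    have hn : |(n : ℝ)| ≤ |R| * 2 := by
      rw [abs_le]
      constructor <;> nlinarith
    rw [abs_le] at hn
    refine key m n (abs_le.2 ?_) (abs_le.2 ?_) <;> constructor <;> linarith
  · change Bool at i j
    have hn : |(n : ℝ)| ≤ |R| + 1 := by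
      cases i <;> cases j <;> simp [pos, base] at him <;> rw [abs_le] <;> constructor <;> nlinarith
    have hm : |(m : ℝ) + n / 2| ≤ |R| + 1 := by
      cases i <;> cases j <;> simp [pos, base] at hre <;> rw [abs_le] <;> constructor <;> nlinarith
    rw [abs_le] at hn hm
    refine key m n (abs_le.2 ?_) (abs_le.2 ?_) <;> constructor <;> linarith

end PlanarLattice

/-! ### Chains of translated links -/

namespace PlanarLattice

variable {L : PlanarLattice}

/-- A finite set of sites whose translates by the multiples of `step` are pairwise disjoint, the only
edges between them leading from the exit of one translate to the entry of the next. -/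
structure ChainLink (L : PlanarLattice) where
  /-- The sites of a link. -/
  carrier : Set L.Site
  finite : carrier.Finite
  /-- The site joined to the previous link. -/
  entry : L.Site
  /-- The site joined to the next link. -/
  exit : L.Site
  /-- The translation from each link to the next. -/
  step : ℤ × ℤ
  entry_mem : entry ∈ carrier
  exit_mem : exit ∈ carrier
  adj : L.graph.Adj exit (L.translate step entry)
  ne_of_mem : ∀ k : ℤ, k ≠ 0 → ∀ x ∈ carrier, ∀ y ∈ carrier, x ≠ L.translate (k • step) y
  eq_of_adj : ∀ k : ℤ, k ≠ 0 → ∀ x ∈ carrier, ∀ y ∈ carrier,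
    L.graph.Adj x (L.translate (k • step) y) →
      (k = 1 ∧ x = exit ∧ y = entry) ∨ (k = -1 ∧ x = entry ∧ y = exit)

namespace ChainLink

variable (c : ChainLink L)

/-- The same chain, traversed in the opposite direction. -/
def reverse : ChainLink L where
  carrier := c.carrier
  finite := c.finite
  entry := c.exit
  exit := c.entry
  step := -c.step
  entry_mem := c.exit_mem
  exit_mem := c.entry_mem
  adj := by
    have h := c.adj.symm
    rwa [translate_adj_left] at h
  ne_of_mem k hk x hx y hy := by
    rw [smul_neg, ← neg_smul]
    exact c.ne_of_mem (-k) (by omega) x hx y hy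
  eq_of_adj k hk x hx y hy h := by
    rw [smul_neg, ← neg_smul] at h
    rcases c.eq_of_adj (-k) (by omega) x hx y hy h with ⟨h1, h2⟩ | ⟨h1, h2⟩
    · exact Or.inr ⟨by omega, h2⟩
    · exact Or.inl ⟨by omega, h2⟩

/-- The copy of `y` in the `k`-th link. -/
def copy (k : ℤ) (y : L.Site) : L.Site := L.translate (k • c.step) y

/-- The configuration with pattern `X k` in the `k`-th link. -/
def config (X : ℤ → Set L.Site) : L.Config := {x | ∃ k, ∃ y ∈ X k, x = c.copy k y}

variable {c}

theorem copy_inj {k k' : ℤ} {y y' : L.Site} (hy : y ∈ c.carrier) (hy' : y' ∈ c.carrier)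
    (h : c.copy k y = c.copy k' y') : k = k' ∧ y = y' := by
  have h1 : y = L.translate ((k' - k) • c.step) y' := by
    have := congrArg (L.translate (-(k • c.step))) h
    simp only [copy, translate_translate, neg_add_cancel, translate_zero] at this
    rw [this, sub_smul]
    congr 1
    abel
  rcases eq_or_ne k k' with rfl | hk
  · exact ⟨rfl, by simpa using h1⟩
  · exact absurd h1 (c.ne_of_mem _ (sub_ne_zero.2 hk.symm) y hy y' hy')

theorem copy_adj_copy (k : ℤ) (y y' : L.Site) :
    L.graph.Adj (c.copy k y) (c.copy k y') ↔ L.graph.Adj y y' := translate_adj _ _ _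

theorem adj_copy_exit (k : ℤ) :
    L.graph.Adj (c.copy k c.exit) (c.copy (k + 1) c.entry) := by
  have h := (translate_adj (k • c.step) _ _).2 c.adj
  rw [translate_translate] at h
  rwa [copy, copy, add_smul, one_smul]

theorem eq_of_copy_adj {k k' : ℤ} {y y' : L.Site} (hy : y ∈ c.carrier) (hy' : y' ∈ c.carrier)
    (h : L.graph.Adj (c.copy k y) (c.copy k' y')) :
    (k' = k ∧ L.graph.Adj y y') ∨ (k' = k + 1 ∧ y = c.exit ∧ y' = c.entry) ∨
      (k = k' + 1 ∧ y = c.entry ∧ y' = c.exit) := by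
  rcases eq_or_ne k' k with rfl | hk
  · exact Or.inl ⟨rfl, (copy_adj_copy _ _ _).1 h⟩
  · rw [copy, copy, translate_adj_left, translate_translate, neg_add_eq_sub,
      ← sub_smul] at h
    rcases c.eq_of_adj (k' - k) (sub_ne_zero.2 hk) y hy y' hy' h with ⟨h1, h2⟩ | ⟨h1, h2⟩
    · exact Or.inr (Or.inl ⟨by omega, h2⟩)
    · exact Or.inr (Or.inr ⟨by omega, h2⟩)

theorem copy_mem_config {X : ℤ → Set L.Site} (hX : ∀ k, X k ⊆ c.carrier) {y : L.Site}
    (hy : y ∈ c.carrier) (k : ℤ) : c.copy k y ∈ c.config X ↔ y ∈ X k := by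
  constructor
  · rintro ⟨k', y', hy', h⟩
    obtain ⟨rfl, rfl⟩ := copy_inj hy (hX _ hy') h
    exact hy'
  · exact fun h => ⟨k, y, h, rfl⟩

@[simp] theorem copy_zero (y : L.Site) : c.copy 0 y = y := by simp [copy]

theorem finite_copies (X : Set ℤ) (hX : X.Finite) :
    {x | ∃ k ∈ X, ∃ y ∈ c.carrier, x = c.copy k y}.Finite := by
  refine (hX.biUnion fun k _ => c.finite.image (c.copy k)).subset ?_
  rintro _ ⟨k, hk, y, hy, rfl⟩
  exact Set.mem_biUnion hk ⟨y, hy, rfl⟩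

/-- If no link joins its entry to its exit, then all clusters are finite. -/
theorem not_hasInfiniteCluster_config {Z : Set L.Site} (hZ : Z ⊆ c.carrier)
    (h : ¬ L.graph.Joined Z c.entry c.exit) : ¬ L.HasInfiniteCluster (c.config fun _ => Z) := by
  rw [hasInfiniteCluster_iff]
  rintro ⟨v, hv, hinf⟩
  set U : Set L.Site := {y | L.graph.Joined Z c.exit y} with hU
  have hwU : c.entry ∉ U := fun hw => h (SimpleGraph.Reachable.symm hw)
  have hUU : ∀ y ∈ U, ∀ z, L.graph.Adj y z → y ∈ Z → z ∈ Z → z ∈ U := fun y hy z hyz h1 h2 =>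
    SimpleGraph.Reachable.trans hy (SimpleGraph.Joined.of_adj hyz h1 h2)
  -- A cluster is trapped between two consecutive breaks: it lies in the exit side `U` of link `k -
  -- 1` together with the complement of `U` in link `k`.
  obtain ⟨k, hk⟩ : ∃ k : ℤ, ∃ y ∈ Z, (y ∈ U ∧ v = c.copy (k - 1) y) ∨ (y ∉ U ∧ v = c.copy k y) := by
    obtain ⟨k, y, hy, rfl⟩ := hv
    by_cases hyU : y ∈ U
    · exact ⟨k + 1, y, hy, Or.inl ⟨hyU, by simp⟩⟩
    · exact ⟨k, y, hy, Or.inr ⟨hyU, rfl⟩⟩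
  refine hinf ((finite_copies (c := c) {k - 1, k} (by simp)).subset (?_ :
    {u | L.graph.Joined (c.config fun _ => Z) v u} ⊆ _))
  have key : {u | L.graph.Joined (c.config fun _ => Z) v u} ⊆
      {v | ∃ y ∈ Z, (y ∈ U ∧ v = c.copy (k - 1) y) ∨ (y ∉ U ∧ v = c.copy k y)} := by
    intro u hu
    refine SimpleGraph.Joined.mem_of_closed hu hk ?_
    rintro _ _ ⟨y, hy, ⟨hyU, rfl⟩ | ⟨hyU, rfl⟩⟩ hadj - ⟨k', z, hz, rfl⟩
    · rcases eq_of_copy_adj (hZ hy) (hZ hz) hadj with ⟨rfl, h1⟩ | ⟨rfl, h1, rfl⟩ | ⟨h0, rfl, rfl⟩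
      · exact ⟨z, hz, Or.inl ⟨hUU y hyU z h1 hy hz, rfl⟩⟩
      · exact ⟨_, hz, Or.inr ⟨hwU, by simp⟩⟩
      · exact absurd hyU hwU
    · rcases eq_of_copy_adj (hZ hy) (hZ hz) hadj with ⟨rfl, h1⟩ | ⟨rfl, rfl, rfl⟩ | ⟨h0, rfl, rfl⟩
      · exact ⟨z, hz, Or.inr ⟨fun hzU => hyU (hUU z hzU y h1.symm hz hy), rfl⟩⟩
      · exact absurd (SimpleGraph.Reachable.refl _) hyU
      · exact ⟨_, hz, Or.inl ⟨SimpleGraph.Reachable.refl _, by simp [h0]⟩⟩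
  intro u hu
  obtain ⟨y, hy, ⟨-, rfl⟩ | ⟨-, rfl⟩⟩ := key hu
  · exact ⟨k - 1, by simp, y, hZ hy, rfl⟩
  · exact ⟨k, by simp, y, hZ hy, rfl⟩

/-- Otherwise the path could never pass beyond the link it starts in, and an injective sequence
would stay in the finitely many links `0, …, κ 0`. -/
theorem exists_exit_of_injective {f : ℕ → L.Site} (hf : Function.Injective f)
    (hadj : ∀ n, L.graph.Adj (f n) (f (n + 1))) {κ : ℕ → ℤ} {y : ℕ → L.Site}
    (hy : ∀ n, y n ∈ c.carrier) (hfy : ∀ n, f n = c.copy (κ n) (y n)) (h0 : ∀ n, 0 ≤ κ n) :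
    ∃ n, f n = c.copy (κ 0) c.exit ∧ f (n + 1) = c.copy (κ 0 + 1) c.entry := by
  by_contra hcon
  have hle : ∀ n, κ n ≤ κ 0 := by
    intro n
    induction n with
    | zero => exact le_rfl
    | succ n ih =>
      have h1 := hadj n
      rw [hfy n, hfy (n + 1)] at h1
      rcases eq_of_copy_adj (hy _) (hy _) h1 with ⟨h2, -⟩ | ⟨h2, h3, h4⟩ | ⟨h2, -⟩
      · omega
      · by_contra h5
        have h6 : κ n = κ 0 := by omega
        exact hcon ⟨n, by rw [hfy, h3, h6], by rw [hfy (n + 1), h4, h2, h6]⟩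
      · omega
  refine Set.infinite_range_of_injective hf
    ((finite_copies (c := c) (Set.Icc 0 (κ 0)) (Set.finite_Icc _ _)).subset ?_)
  rintro _ ⟨n, rfl⟩
  exact ⟨κ n, ⟨h0 n, hle n⟩, y n, hy n, hfy n⟩

/-- A chain that is infinite in one direction only contains no doubly-infinite path. -/
theorem false_of_path_nonneg {γ : ℤ → L.Site} (hγ : L.IsDoublyInfiniteSelfRepellingPath γ)
    (h : ∀ n, ∃ k : ℤ, 0 ≤ k ∧ ∃ y ∈ c.carrier, γ n = c.copy k y) : False := by
  choose κ hκ y hy hγy using h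
  -- Both halves of the path start at `γ 0`, hence must leave the same link through the same edge,
  -- in the same direction. This contradicts injectivity.
  obtain ⟨n, hn, hn'⟩ := exists_exit_of_injective (c := c) (f := fun n => γ n) (κ := fun n => κ n)
    (y := fun n => y n) (hγ.injective.comp Nat.cast_injective) (fun n => by
      simpa using hγ.adj_succ n) (fun n => hy n) (fun n => hγy n) (fun n => hκ n)
  obtain ⟨m, hm, hm'⟩ := exists_exit_of_injective (c := c) (f := fun n => γ (-n))
    (κ := fun n => κ (-n)) (y := fun n => y (-n))
    (hγ.injective.comp (neg_injective.comp Nat.cast_injective)) (fun n => by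
      have := (hγ.adj_succ (-(n + 1))).symm
      rw [show -((n : ℤ) + 1) + 1 = -n by ring] at this
      simpa using this) (fun n => hy _) (fun n => hγy _) (fun n => hκ _)
  have h1 := hγ.injective (hn.trans (Eq.trans (by simp) hm.symm))
  have h2 := hγ.injective (hn'.trans (Eq.trans (by simp) hm'.symm))
  push_cast at h1 h2
  omega

/-- If some link does not join its entry to its exit, then there is no doubly-infinite path. -/
theorem not_containsPath_config {X : ℤ → Set L.Site} (hX : ∀ k, X k ⊆ c.carrier)
    (h : ¬ L.graph.Joined (X 0) c.entry c.exit) :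
    ¬ L.ContainsDoublyInfiniteSelfRepellingPath (c.config X) := by
  rintro ⟨γ, hγ, hω⟩
  set U : Set L.Site := {y | L.graph.Joined (X 0) c.entry y} with hU
  have hUU : ∀ y ∈ U, ∀ z, L.graph.Adj y z → y ∈ X 0 → z ∈ X 0 → z ∈ U := fun y hy z hyz h1 h2 =>
    SimpleGraph.Reachable.trans hy (SimpleGraph.Joined.of_adj hyz h1 h2)
  -- The sites to the left of the break in link `0`. No open edge leaves this set, so the whole path
  -- lies on one side of the break, in a chain infinite in one direction only.
  let P : L.Site → Prop := fun x => ∃ k : ℤ, ∃ y ∈ X k, x = c.copy k y ∧ (k < 0 ∨ (k = 0 ∧ y ∈ U))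
  have hstep : ∀ x x', L.graph.Adj x x' → x' ∈ c.config X → P x → P x' := by
    rintro _ _ hadj ⟨k', z, hz, rfl⟩ ⟨k, y, hy, rfl, hk⟩
    refine ⟨k', z, hz, rfl, ?_⟩
    rcases eq_of_copy_adj (hX _ hy) (hX _ hz) hadj with ⟨rfl, h1⟩ | ⟨rfl, rfl, rfl⟩ | ⟨rfl, rfl, rfl⟩
    · rcases hk with hk | ⟨rfl, hk⟩
      · exact Or.inl hk
      · exact Or.inr ⟨rfl, hUU y hk z h1 hy hz⟩
    · rcases hk with hk | ⟨rfl, hk⟩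
      · rcases (by omega : k + 1 < 0 ∨ k + 1 = 0) with hk | hk
        · exact Or.inl hk
        · exact Or.inr ⟨hk, SimpleGraph.Reachable.refl _⟩
      · exact absurd hk h
    · exact Or.inl (by omega)
  have hall : ∀ n, P (γ n) ↔ P (γ 0) := by
    have h1 : ∀ n, P (γ n) ↔ P (γ (n + 1)) := fun n =>
      ⟨hstep _ _ (hγ.adj_succ n) (hω _), hstep _ _ (hγ.adj_succ n).symm (hω _)⟩
    intro n
    induction n with
    | zero => exact Iff.rfl
    | succ n ih => rw [← h1, ih]
    | pred n ih => rw [h1, sub_add_cancel, ih]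
  by_cases hP : P (γ 0)
  · refine false_of_path_nonneg (c := c.reverse) hγ fun n => ?_
    obtain ⟨k, y, hy, hn, hk⟩ := (hall n).2 hP
    exact ⟨-k, by omega, y, hX _ hy, by simpa [copy, reverse] using hn⟩
  · refine false_of_path_nonneg (c := c) hγ fun n => ?_
    obtain ⟨k, y, hy, hn⟩ := hω n
    refine ⟨k, ?_, y, hX _ hy, hn⟩
    by_contra hk
    exact hP ((hall n).1 ⟨k, y, hy, hn, Or.inl (by omega)⟩)

/-- If all links join their entries to their exits, then there is a doubly-infinite path. -/
theorem containsPath_config {Z : Set L.Site} (hZ : Z ⊆ c.carrier) (hw : c.entry ∈ Z)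
    (h : L.graph.Joined Z c.entry c.exit) :
    L.ContainsDoublyInfiniteSelfRepellingPath (c.config fun _ => Z) := by
  obtain ⟨d, f, hf0, hfd, hfZ, hfadj, hfinj, hfrep⟩ := h.exists_geodesic hw
  have hpos : (0 : ℤ) < d + 1 := by positivity
  -- A shortest path from entry to exit has `d + 1` sites; its copies in successive links are
  -- concatenated.
  let γ : ℤ → L.Site := fun n => c.copy (n / (d + 1)) (f (n % (d + 1)).toNat)
  have hr : ∀ n : ℤ, ((n % (d + 1)).toNat : ℤ) = n % (d + 1) ∧ (n % (d + 1)).toNat ≤ d := by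
    intro n
    have h1 := Int.emod_nonneg n hpos.ne'
    have h2 := Int.emod_lt_of_pos n hpos
    omega
  have hn : ∀ n : ℤ, (d + 1 : ℤ) * (n / (d + 1)) + (n % (d + 1)).toNat = n := fun n => by
    rw [(hr n).1, Int.mul_ediv_add_emod]
  have hγ : ∀ (k : ℤ) (i : ℕ), i ≤ d → γ ((d + 1) * k + i) = c.copy k (f i) := by
    intro k i hi
    have h1 : ((d + 1 : ℤ) * k + i) / (d + 1) = k := by
      rw [add_comm, Int.add_mul_ediv_left _ _ hpos.ne', Int.ediv_eq_zero_of_lt (by omega) (by omega),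
        zero_add]
    have h2 : ((d + 1 : ℤ) * k + i) % (d + 1) = i := by
      rw [add_comm, Int.add_mul_emod_self_left, Int.emod_eq_of_lt (by omega) (by omega)]
    simp only [γ, h1, h2, Int.toNat_natCast]
  have hdec : ∀ n : ℤ, ∃ (k : ℤ) (i : ℕ), i ≤ d ∧ n = (d + 1) * k + i := fun n =>
    ⟨_, _, (hr n).2, (hn n).symm⟩
  refine ⟨γ, ⟨?_, ?_, ?_⟩, fun n => ⟨_, _, hfZ _, rfl⟩⟩
  · intro m n hmn
    obtain ⟨k, i, hi, rfl⟩ := hdec m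
    obtain ⟨l, j, hj, rfl⟩ := hdec n
    rw [hγ k i hi, hγ l j hj] at hmn
    obtain ⟨rfl, h2⟩ := copy_inj (hZ (hfZ _)) (hZ (hfZ _)) hmn
    rw [hfinj i hi j hj h2]
  · intro n
    obtain ⟨k, i, hi, rfl⟩ := hdec n
    rw [hγ k i hi]
    rcases hi.lt_or_eq with hi | rfl
    · have := hγ k (i + 1) hi
      rw [Nat.cast_succ, ← add_assoc] at this
      rw [this, copy_adj_copy]
      exact hfadj i hi
    · have := hγ (k + 1) 0 (Nat.zero_le _)
      rw [show ((i : ℤ) + 1) * (k + 1) + (0 : ℕ) = (i + 1) * k + i + 1 by push_cast; ring] at this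
      rw [this, hf0, hfd]
      exact adj_copy_exit k
  · intro m n hmn
    obtain ⟨k, i, hi, rfl⟩ := hdec m
    obtain ⟨l, j, hj, rfl⟩ := hdec n
    rw [hγ k i hi, hγ l j hj] at hmn
    rcases eq_of_copy_adj (hZ (hfZ _)) (hZ (hfZ _)) hmn with ⟨rfl, h1⟩ | ⟨rfl, h1, h2⟩ | ⟨rfl, h1, h2⟩
    · rcases hfrep i hi j hj h1 with rfl | rfl
      · exact Or.inl (by push_cast; ring)
      · exact Or.inr (by push_cast; ring)
    · have hi := hfinj i hi d le_rfl (h1.trans hfd.symm)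
      have hj := hfinj j hj 0 (Nat.zero_le _) (h2.trans hf0.symm)
      rw [hi, hj]
      exact Or.inl (by push_cast; ring)
    · have hi := hfinj i hi 0 (Nat.zero_le _) (h1.trans hf0.symm)
      have hj := hfinj j hj d le_rfl (h2.trans hfd.symm)
      rw [hi, hj]
      exact Or.inr (by push_cast; ring)

end ChainLink

end PlanarLattice

/-! ### Gadgets, and what a routed gadget produces -/

namespace PlanarLattice

variable {L : PlanarLattice}

/-- `p` lies just outside the box. -/
def IsExit (L : PlanarLattice) (N : ℤ) (p : L.Site) : Prop :=
  p ∉ L.siteBox N ∧ ∃ f ∈ L.siteBox N, L.graph.Adj p f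

/-- Disjoint arms from the exits `p` and `q` of a box that connect the box to its translates. -/
structure Routing (L : PlanarLattice) (N : ℤ) (p q : L.Site) where
  /-- The box with its arms. -/
  link : ChainLink L
  /-- The arm from `p`. -/
  armP : Set L.Site
  /-- The arm from `q`. -/
  armQ : Set L.Site
  box_subset : L.siteBox N ⊆ link.carrier
  armP_subset : armP ⊆ link.carrier
  armQ_subset : armQ ⊆ link.carrier
  mem_armP : p ∈ armP
  mem_armQ : q ∈ armQ
  joined_armP : L.graph.Joined armP p link.entry
  joined_armQ : L.graph.Joined armQ q link.exit
  notMem_box_of_armP : ∀ x ∈ armP, x ∉ L.siteBox N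
  notMem_box_of_armQ : ∀ x ∈ armQ, x ∉ L.siteBox N
  ne : ∀ x ∈ armP, ∀ y ∈ armQ, x ≠ y
  not_adj : ∀ x ∈ armP, ∀ y ∈ armQ, ¬ L.graph.Adj x y
  eq_of_adj_armP : ∀ x ∈ armP, ∀ f ∈ L.siteBox N, L.graph.Adj x f → x = p
  eq_of_adj_armQ : ∀ x ∈ armQ, ∀ f ∈ L.siteBox N, L.graph.Adj x f → x = q

end PlanarLattice

open PlanarLattice

namespace Enhancement

variable {L : PlanarLattice} {φ : Enhancement L}

/-- The box contains the enhancement range. -/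
def RangeIn (φ : Enhancement L) (N : ℤ) : Prop :=
  ∀ i : L.Orbit,
    (∀ ω ω' : L.Config, ω ∩ L.siteBox N = ω' ∩ L.siteBox N → φ.baseFun i ω = φ.baseFun i ω') ∧
    ∀ ω : L.Config, φ.baseFun i ω ⊆ L.siteBox N

theorem exists_rangeIn (φ : Enhancement L) : ∃ N : ℕ, φ.RangeIn N := by
  obtain ⟨R, hR⟩ := φ.local_range
  obtain ⟨N, hN⟩ := exists_ball_subset_siteBox (L := L) R
  refine ⟨N, fun i => ⟨fun ω ω' h => (hR i).1 ω ω' ?_, fun ω => ((hR i).2 ω).trans (hN i)⟩⟩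
  rw [← Set.inter_eq_self_of_subset_right (hN i), ← Set.inter_assoc, h, Set.inter_assoc]

/-- Some configuration inside the box does not join two of its exits, but does so once enhanced. -/
def HasGadget (φ : Enhancement L) (N : ℤ) : Prop :=
  ∃ (i : L.Orbit) (ζ : L.Config) (p q : L.Site), ζ ⊆ L.siteBox N ∧ L.IsExit N p ∧ L.IsExit N q ∧
    p ≠ q ∧ ¬ L.graph.Adj p q ∧ ¬ L.graph.Joined (ζ ∪ {p, q}) p q ∧
    L.graph.Joined (ζ ∪ {p, q} ∪ φ.baseFun i ζ) p q

/-- The arms meet the box only through `p` and `q`, so a link joins its entry to its exit exactly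
when the box part joins `p` to `q`. For essentiality only link `0` is left unenhanced; for the
infinite cluster all links start unenhanced and every site is activated. -/
theorem essential_and_canCreate_of_routing {N : ℤ} (hN : φ.RangeIn N) {i : L.Orbit} {ζ : L.Config}
    {p q : L.Site} (hζ : ζ ⊆ L.siteBox N) (r : Routing L N p q)
    (h : ¬ L.graph.Joined (ζ ∪ {p, q}) p q)
    (h' : L.graph.Joined (ζ ∪ {p, q} ∪ φ.baseFun i ζ) p q) :
    φ.Essential ∧ φ.CanCreateInfiniteCluster := by
  set c := r.link with hc
  set Z : Set L.Site := ζ ∪ (r.armP ∪ r.armQ) with hZ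
  set Z' : Set L.Site := Z ∪ φ.baseFun i ζ with hZ'
  have hZc : Z ⊆ c.carrier :=
    Set.union_subset (hζ.trans r.box_subset) (Set.union_subset r.armP_subset r.armQ_subset)
  have hZc' : Z' ⊆ c.carrier := Set.union_subset hZc (((hN i).2 ζ).trans r.box_subset)
  have hwA : c.entry ∈ r.armP := r.joined_armP.mem r.mem_armP
  have heB : c.exit ∈ r.armQ := r.joined_armQ.mem r.mem_armQ
  have hbox : ∀ x ∈ L.siteBox N, x ∈ Z ↔ x ∈ ζ := fun x hx => by
    refine ⟨?_, Or.inl⟩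
    rintro (h | h | h)
    · exact h
    · exact absurd hx (r.notMem_box_of_armP x h)
    · exact absurd hx (r.notMem_box_of_armQ x h)
  have hnot : ¬ L.graph.Joined Z c.entry c.exit := by
    intro hj
    -- The arm of `p` together with the part of `ζ` joined to `p` is closed under adjacency in `Z`:
    -- the only way into the other arm is through `q`.
    have hmem : c.exit ∈ r.armP ∪ {y | y ∈ ζ ∧ L.graph.Joined (ζ ∪ {p, q}) p y} := by
      refine hj.mem_of_closed (Or.inl hwA) ?_
      rintro y z (hy | ⟨hyζ, hy⟩) hyz - (hz | hz | hz)
      · have hyp := r.eq_of_adj_armP y hy z (hζ hz) hyz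
        subst hyp
        exact Or.inr ⟨hz, SimpleGraph.Joined.of_adj hyz (by simp) (Or.inl hz)⟩
      · exact Or.inl hz
      · exact absurd hyz (r.not_adj y hy z hz)
      · exact Or.inr ⟨hz, hy.trans (SimpleGraph.Joined.of_adj hyz (Or.inl hyζ) (Or.inl hz))⟩
      · exact Or.inl hz
      · have hzq := r.eq_of_adj_armQ z hz y (hζ hyζ) hyz.symm
        subst hzq
        exact absurd (hy.trans (SimpleGraph.Joined.of_adj hyz (Or.inl hyζ) (by simp))) h
    rcases hmem with hm | hm
    · exact r.ne _ hm _ heB rfl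
    · exact r.notMem_box_of_armQ _ heB (hζ hm.1)
  have hjoin : L.graph.Joined Z' c.entry c.exit := by
    have h1 : L.graph.Joined Z' c.entry p :=
      (r.joined_armP.mono fun x hx => Or.inl (Or.inr (Or.inl hx))).symm
    have h2 : L.graph.Joined Z' p q := by
      refine h'.mono ?_
      rintro x ((hx | rfl | rfl) | hx)
      · exact Or.inl (Or.inl hx)
      · exact Or.inl (Or.inr (Or.inl r.mem_armP))
      · exact Or.inl (Or.inr (Or.inr r.mem_armQ))
      · exact Or.inr hx
    have h3 : L.graph.Joined Z' q c.exit :=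
      r.joined_armQ.mono fun x hx => Or.inl (Or.inr (Or.inr hx))
    exact (h1.trans h2).trans h3
  have hpath : L.ContainsDoublyInfiniteSelfRepellingPath (c.config fun _ => Z') :=
    ChainLink.containsPath_config hZc' (Or.inl (Or.inr (Or.inl hwA))) hjoin
  constructor
  · let X : ℤ → Set L.Site := fun k => if k = 0 then Z else Z'
    have hX : ∀ k, X k ⊆ c.carrier := fun k => by
      by_cases hk : k = 0
      · simpa [X, hk] using hZc
      · simpa [X, hk] using hZc'
    have hφ : φ.baseFun i (c.config X) = φ.baseFun i ζ := by
      refine (hN i).1 _ _ (Set.ext fun x => and_congr_left fun hx => ?_)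
      have := ChainLink.copy_mem_config hX (r.box_subset hx) 0
      rw [ChainLink.copy_zero] at this
      rw [this, ← hbox x hx]
      simp [X]
    refine ⟨i, c.config X, ChainLink.not_containsPath_config hX (by simpa [X] using hnot),
      hpath.mono ?_⟩
    rintro _ ⟨k, y, hy, rfl⟩
    by_cases hk : k = 0
    · rcases hy with hy | hy
      · exact Or.inl ⟨k, y, by simpa [X, hk] using hy, rfl⟩
      · right
        rw [hφ, hk]
        simpa using hy
    · exact Or.inl ⟨k, y, by simpa [X, hk] using hy, rfl⟩
  · refine ⟨c.config fun _ => Z, ChainLink.not_hasInfiniteCluster_config hZc hnot, fun _ => true,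
      hpath.hasInfiniteCluster.mono ?_⟩
    rintro _ ⟨k, y, hy, rfl⟩
    rcases hy with hy | hy
    · exact Or.inl ⟨k, y, hy, rfl⟩
    · right
      simp only [Set.mem_iUnion]
      -- Seen from the base of link `k`, the configuration inside the box is exactly `ζ`.
      refine ⟨(k • c.step, i), trivial, y, ?_, rfl⟩
      have hφ : φ.baseFun i (L.shift (k • c.step) (c.config fun _ => Z)) = φ.baseFun i ζ := by
        refine (hN i).1 _ _ (Set.ext fun x => and_congr_left fun hx => ?_)
        exact (ChainLink.copy_mem_config (fun _ => hZc) (r.box_subset hx) k).trans (hbox x hx)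
      rw [hφ]
      exact hy

/-- If enhancement at the base site joins two open sites outside the box, then there is a gadget. -/
theorem hasGadget_of_joined {N : ℤ} (hN : φ.RangeIn N) {i : L.Orbit} {ω : L.Config} {u v : L.Site}
    (hu' : u ∉ L.siteBox N) (hv' : v ∉ L.siteBox N)
    (h : L.graph.Joined (ω ∪ φ.baseFun i ω) u v) (h' : ¬ L.graph.Joined ω u v) :
    φ.HasGadget N := by
  by_contra hcon
  have hφ : φ.baseFun i (ω ∩ L.siteBox N) = φ.baseFun i ω :=
    (hN i).1 _ _ (by rw [Set.inter_assoc, Set.inter_self])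
  have hout : ∀ x ∈ ω ∪ φ.baseFun i ω, x ∉ L.siteBox N → x ∈ ω := fun x hx hxN =>
    hx.resolve_right fun h => hxN ((hN i).2 _ h)
  -- Invariant along the enhanced path: outside the box nothing new is joined to `u`; inside, the
  -- last entrance `p` is remembered, together with an enhanced connection from it within the box.
  let P : L.Site → Prop := fun y => (y ∉ L.siteBox N → L.graph.Joined ω u y) ∧
    (y ∈ L.siteBox N → ∃ p ∈ ω, L.IsExit N p ∧ L.graph.Joined ω u p ∧
      L.graph.Joined ((ω ∩ L.siteBox N) ∪ {p} ∪ φ.baseFun i ω) p y)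
  have key : P v := by
    refine h.induction (P := P) ⟨fun _ => SimpleGraph.Reachable.refl _, fun h => absurd h hu'⟩ ?_
    rintro y z ⟨hy1, hy2⟩ hyz hyω hzω
    have hmem : ∀ p : L.Site, ∀ x ∈ ω ∪ φ.baseFun i ω, x ∈ L.siteBox N →
        x ∈ (ω ∩ L.siteBox N) ∪ {p} ∪ φ.baseFun i ω := fun p x hx hxN =>
      hx.elim (fun h => Or.inl (Or.inl ⟨h, hxN⟩)) Or.inr
    by_cases hyN : y ∈ L.siteBox N
    · obtain ⟨p, hp, hpe, hup, hpy⟩ := hy2 hyN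
      refine ⟨fun hzN => ?_, fun hzN => ⟨p, hp, hpe, hup, hpy.trans
        (SimpleGraph.Joined.of_adj hyz (hmem p y hyω hyN) (hmem p z hzω hzN))⟩⟩
      have hz := hout z hzω hzN
      refine hup.trans ?_
      by_contra hpz
      -- The path leaves the box at `z`. If `z` were not joined to `p` in `ω`, then `p` and `z`
      -- would be distinct, non-adjacent exits forming a gadget.
      refine hcon ⟨i, ω ∩ L.siteBox N, p, z, Set.inter_subset_right, hpe, ⟨hzN, y, hyN, hyz.symm⟩,
        ?_, ?_, ?_, ?_⟩
      · rintro rfl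
        exact hpz (SimpleGraph.Reachable.refl _)
      · exact fun h => hpz (SimpleGraph.Joined.of_adj h hp hz)
      · refine fun h => hpz (h.mono ?_)
        rintro x (hx | rfl | rfl)
        · exact hx.1
        · exact hp
        · exact hz
      · rw [hφ]
        refine SimpleGraph.Reachable.trans (hpy.mono ?_) (SimpleGraph.Joined.of_adj hyz ?_ (by simp))
        · rintro x ((hx | rfl) | hx)
          · exact Or.inl (Or.inl hx)
          · simp
          · exact Or.inr hx
        · exact hyω.elim (fun h => Or.inl (Or.inl ⟨h, hyN⟩)) Or.inr
    · have hy := hout y hyω hyN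
      refine ⟨fun hzN => (hy1 hyN).trans (SimpleGraph.Joined.of_adj hyz hy (hout z hzω hzN)),
        fun hzN => ⟨y, hy, ⟨hyN, z, hzN, hyz⟩, hy1 hyN,
          SimpleGraph.Joined.of_adj hyz (by simp) (hmem y z hzω hzN)⟩⟩
  exact h' (key.1 hv')

end Enhancement

/-! ### Escape to infinity, shifts, and closing up the ends of a path -/

namespace PlanarLattice

variable {L : PlanarLattice}

theorem joined_horizontal {S : Set (ℤ × ℤ)} {a b y : ℤ} (hab : a ≤ b)
    (h : ∀ t, a ≤ t → t ≤ b → (t, y) ∈ S) : cellGraph.Joined S (a, y) (b, y) := by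
  induction b, hab using Int.leInduction with
  | base => exact SimpleGraph.Reachable.refl _
  | succ n hn ih =>
    exact (ih fun t h1 h2 => h t h1 (by omega)).trans
      (SimpleGraph.Joined.of_adj (by simp [cellGraph, IsStep]) (h n hn (by omega))
        (h _ (by omega) le_rfl))

theorem joined_vertical {S : Set (ℤ × ℤ)} {a b x : ℤ} (hab : a ≤ b)
    (h : ∀ t, a ≤ t → t ≤ b → (x, t) ∈ S) : cellGraph.Joined S (x, a) (x, b) := by
  induction b, hab using Int.leInduction with
  | base => exact SimpleGraph.Reachable.refl _
  | succ n hn ih =>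
    exact (ih fun t h1 h2 => h t h1 (by omega)).trans
      (SimpleGraph.Joined.of_adj (by simp [cellGraph, IsStep]) (h n hn (by omega))
        (h _ (by omega) le_rfl))

/-- Outside a box one can go to infinity. -/
theorem exists_joined_compl_siteBox {M : ℤ} {x : L.Site} (hx : x ∉ L.siteBox M) (J : ℤ) :
    ∃ y, y ∉ L.siteBox M ∧ y ∉ L.siteBox J ∧ L.graph.Joined (L.siteBox M)ᶜ x y := by
  obtain ⟨⟨a, b⟩, i⟩ := x
  have key : ∃ d : ℤ × ℤ, d ∉ cellBox M ∧ d ∉ cellBox J ∧ cellGraph.Joined (cellBox M)ᶜ (a, b) d := by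
    simp only [siteBox, cellSites, cellBox, Set.mem_ofPred_eq, not_and_or, not_le] at hx ⊢
    rcases (by omega : M < a ∨ a < -M ∨ M < b ∨ b < -M) with h | h | h | h
    · refine ⟨(max a (J + 1), b), by dsimp only; omega, by dsimp only; omega,
        joined_horizontal (by omega) fun t h1 h2 => ?_⟩
      simp only [Set.mem_compl_iff, Set.mem_ofPred_eq]
      omega
    · refine ⟨(min a (-J - 1), b), by dsimp only; omega, by dsimp only; omega,
        (joined_horizontal (by omega) fun t h1 h2 => ?_).symm⟩
      simp only [Set.mem_compl_iff, Set.mem_ofPred_eq]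
      omega
    · refine ⟨(a, max b (J + 1)), by dsimp only; omega, by dsimp only; omega,
        joined_vertical (by omega) fun t h1 h2 => ?_⟩
      simp only [Set.mem_compl_iff, Set.mem_ofPred_eq]
      omega
    · refine ⟨(a, min b (-J - 1)), by dsimp only; omega, by dsimp only; omega,
        (joined_vertical (by omega) fun t h1 h2 => ?_).symm⟩
      simp only [Set.mem_compl_iff, Set.mem_ofPred_eq]
      omega
  obtain ⟨d, h1, h2, h3⟩ := key
  exact ⟨(d, i), h1, h2, joined_cellSites (L := L) (x := ((a, b), i)) (y := (d, i)) hx h3⟩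

theorem siteBox_mono {M N : ℤ} (h : M ≤ N) : L.siteBox M ⊆ L.siteBox N := fun x hx => by
  simp only [siteBox, cellSites, cellBox, Set.mem_ofPred_eq] at hx ⊢
  omega

theorem mem_siteBox_add_one_of_adj {N : ℤ} {x y : L.Site} (hx : x ∈ L.siteBox N)
    (h : L.graph.Adj x y) : y ∈ L.siteBox (N + 1) := by
  have := near_of_adj h
  simp only [siteBox, cellSites, cellBox, Near, Set.mem_ofPred_eq] at hx this ⊢
  omega

theorem joined_shift {ω : L.Config} {u v : L.Site} (t : ℤ × ℤ) (h : L.graph.Joined ω u v) :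
    L.graph.Joined (L.shift t ω) (L.translate (-t) u) (L.translate (-t) v) :=
  h.map _ fun y z hyz hy hz => SimpleGraph.Joined.of_adj ((translate_adj _ _ _).2 hyz)
    (by simpa [shift] using hy) (by simpa [shift] using hz)

theorem joined_of_shift {ω : L.Config} {u v : L.Site} (t : ℤ × ℤ)
    (h : L.graph.Joined (L.shift t ω) (L.translate (-t) u) (L.translate (-t) v)) :
    L.graph.Joined ω u v := by
  have := SimpleGraph.Joined.map (H := L.graph) (T := ω) (L.translate t)
    (fun y z hyz hy hz => SimpleGraph.Joined.of_adj ((translate_adj _ _ _).2 hyz) hy hz) h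
  simpa using this

/-- In a configuration that consists of the two ends of a self-repelling path and a part that is
not adjacent to them, the ends are not joined unless there is a doubly-infinite path. -/
theorem containsPath_of_joined_ends {γ : ℤ → L.Site} (hγ : L.IsDoublyInfiniteSelfRepellingPath γ)
    {ω : L.Config} {n₁ : ℤ} (hn₁ : 1 ≤ n₁) (hω : ∀ n, n₁ ≤ n ∨ n ≤ -n₁ → γ n ∈ ω)
    (hadj : ∀ n, n₁ < n ∨ n < -n₁ → ∀ z ∈ ω, L.graph.Adj (γ n) z → ∃ m, z = γ m)
    (h : L.graph.Joined ω (γ n₁) (γ (-n₁))) : L.ContainsDoublyInfiniteSelfRepellingPath ω := by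
  classical
  set E : Set L.Site := {x | ∃ n, (n₁ < n ∨ n < -n₁) ∧ x = γ n} with hE
  have hnb : ∀ n, n₁ < n ∨ n < -n₁ → ∀ z ∈ ω, L.graph.Adj (γ n) z →
      ∃ m, z = γ m ∧ (m = n + 1 ∨ n = m + 1) := by
    intro n hn z hz hnz
    obtain ⟨m, rfl⟩ := hadj n hn z hz hnz
    exact ⟨m, rfl, hγ.repelling n m hnz⟩
  have hend : ∀ m, m = n₁ ∨ m = -n₁ → γ m ∉ E := by
    rintro m hm ⟨n, hn, h⟩
    have := hγ.injective h
    omega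
  -- Collapses each tail to its end point. Applied to a connection of the ends, `r` yields one that
  -- avoids both tails.
  let r : L.Site → L.Site := fun x => if ∃ n, n₁ < n ∧ x = γ n then γ n₁ else
    if ∃ n, n < -n₁ ∧ x = γ n then γ (-n₁) else x
  have hr1 : ∀ n, n₁ ≤ n → r (γ n) = γ n₁ := by
    intro n hn
    rcases hn.lt_or_eq with hn | rfl
    · exact if_pos ⟨n, hn, rfl⟩
    · by_cases h : ∃ n, n₁ < n ∧ γ n₁ = γ n
      · exact if_pos h
      · refine (if_neg h).trans (if_neg ?_)
        rintro ⟨m, hm, h⟩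
        have := hγ.injective h
        omega
  have hr2 : ∀ n, n ≤ -n₁ → r (γ n) = γ (-n₁) := by
    intro n hn
    have h0 : ¬ ∃ m, n₁ < m ∧ γ n = γ m := by
      rintro ⟨m, hm, h⟩
      have := hγ.injective h
      omega
    refine (if_neg h0).trans ?_
    rcases hn.lt_or_eq with hn | rfl
    · exact if_pos ⟨n, hn, rfl⟩
    · exact ite_self _
  have hr3 : ∀ x, x ∉ E → r x = x := fun x hx => by
    refine (if_neg ?_).trans (if_neg ?_)
    · rintro ⟨n, hn, h⟩
      exact hx ⟨n, Or.inl hn, h⟩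
    · rintro ⟨n, hn, h⟩
      exact hx ⟨n, Or.inr hn, h⟩
  have hEr : ∀ x ∈ E, ∀ z ∈ ω, L.graph.Adj x z → r x = r z := by
    rintro _ ⟨n, hn, rfl⟩ z hz hxz
    obtain ⟨m, rfl, hm⟩ := hnb n hn z hz hxz
    rcases hn with hn | hn
    · rw [hr1 n hn.le, hr1 m (by omega)]
    · rw [hr2 n hn.le, hr2 m (by omega)]
  have hjoin : L.graph.Joined (ω \ E) (r (γ n₁)) (r (γ (-n₁))) := by
    refine h.map r fun y z hyz hy hz => ?_
    by_cases hyE : y ∈ E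
    · rw [hEr y hyE z hz hyz]
    · by_cases hzE : z ∈ E
      · rw [hEr z hzE y hy hyz.symm]
      · rw [hr3 y hyE, hr3 z hzE]
        exact SimpleGraph.Joined.of_adj hyz ⟨hy, hyE⟩ ⟨hz, hzE⟩
  rw [hr1 _ le_rfl, hr2 _ le_rfl] at hjoin
  obtain ⟨d, f, hf0, hfd, hfω, hfadj, hfinj, hfrep⟩ :=
    hjoin.exists_geodesic ⟨hω _ (Or.inl le_rfl), hend _ (Or.inl rfl)⟩
  have hd : 0 < d := by
    rcases Nat.eq_zero_or_pos d with rfl | h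
    · have := hγ.injective (hf0.symm.trans hfd)
      omega
    · exact h
  -- The first tail traversed inwards, the shortest connection on `0, …, d`, then the second tail
  -- outwards. A tail touches the connection only at its own end, since its neighbours in `ω` are
  -- its neighbours along `γ`.
  let γ' : ℤ → L.Site := fun n => if n < 0 then γ (n₁ - n) else
    if n ≤ d then f n.toNat else γ (-n₁ - n + d)
  have hγ1 : ∀ n, n ≤ 0 → γ' n = γ (n₁ - n) := by
    intro n hn
    rcases hn.lt_or_eq with hn | rfl
    · exact if_pos hn
    · simp [γ', hf0]
  have hγ2 : ∀ i : ℕ, i ≤ d → γ' i = f i := by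
    intro i hi
    simp [γ', hi]
  have hγ3 : ∀ n : ℤ, d ≤ n → γ' n = γ (-n₁ - n + d) := by
    intro n hn
    rcases hn.lt_or_eq with hn | rfl
    · simp only [γ']
      rw [if_neg (by omega), if_neg (by omega)]
    · rw [hγ2 d le_rfl, hfd]
      congr 1
      ring
  have hdec : ∀ n : ℤ, n < 0 ∨ (∃ i : ℕ, i ≤ d ∧ n = i) ∨ d < n := by
    intro n
    rcases lt_or_ge n 0 with h | h
    · exact Or.inl h
    · obtain ⟨i, rfl⟩ := Int.eq_ofNat_of_zero_le h
      rcases le_or_gt i d with h | h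
      · exact Or.inr (Or.inl ⟨i, h, rfl⟩)
      · exact Or.inr (Or.inr (by omega))
  have hfE : ∀ i n, n₁ < n ∨ n < -n₁ → f i ≠ γ n := fun i n hn h => (hfω i).2 ⟨n, hn, h⟩
  have hfadjE : ∀ i ≤ d, ∀ n, n₁ < n ∨ n < -n₁ → L.graph.Adj (γ n) (f i) →
      (n = n₁ + 1 ∧ i = 0) ∨ (n = -n₁ - 1 ∧ i = d) := by
    intro i hi n hn h
    obtain ⟨m, hm, hmn⟩ := hnb n hn _ (hfω i).1 h
    have : ¬ (n₁ < m ∨ m < -n₁) := fun h => hfE i m h hm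
    rcases (by omega : (m = n₁ ∧ n = n₁ + 1) ∨ (m = -n₁ ∧ n = -n₁ - 1)) with ⟨rfl, h1⟩ | ⟨rfl, h1⟩
    · exact Or.inl ⟨h1, hfinj i hi 0 (Nat.zero_le _) (hm.trans hf0.symm)⟩
    · exact Or.inr ⟨h1, hfinj i hi d le_rfl (hm.trans hfd.symm)⟩
  have hrep : ∀ m n, m ≤ n → L.graph.Adj (γ' m) (γ' n) → n = m + 1 := by
    intro m n hle h
    rcases hdec m with hm | ⟨i, hi, rfl⟩ | hm <;> rcases hdec n with hn | ⟨j, hj, rfl⟩ | hn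
    · rw [hγ1 m hm.le, hγ1 n hn.le] at h
      have := hγ.repelling _ _ h
      omega
    · rw [hγ1 m hm.le, hγ2 j hj] at h
      have := hfadjE j hj _ (Or.inl (by omega)) h
      omega
    · rw [hγ1 m hm.le, hγ3 n hn.le] at h
      have := hγ.repelling _ _ h
      omega
    · omega
    · rw [hγ2 i hi, hγ2 j hj] at h
      have := hfrep i hi j hj h
      omega
    · rw [hγ2 i hi, hγ3 n hn.le] at h
      have := hfadjE i hi _ (Or.inr (by omega)) h.symm
      omega
    · omega
    · omega
    · rw [hγ3 m hm.le, hγ3 n hn.le] at h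
      have := hγ.repelling _ _ h
      omega
  refine ⟨γ', ⟨?_, ?_, ?_⟩, ?_⟩
  · have hinj : ∀ m n, m ≤ n → γ' m = γ' n → m = n := by
      intro m n hle h
      rcases hdec m with hm | ⟨i, hi, rfl⟩ | hm <;> rcases hdec n with hn | ⟨j, hj, rfl⟩ | hn
      · rw [hγ1 m hm.le, hγ1 n hn.le] at h
        have := hγ.injective h
        omega
      · rw [hγ1 m hm.le, hγ2 j hj] at h
        exact absurd h.symm (hfE j _ (Or.inl (by omega)))
      · rw [hγ1 m hm.le, hγ3 n hn.le] at h
        have := hγ.injective h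
        omega
      · omega
      · rw [hγ2 i hi, hγ2 j hj] at h
        rw [hfinj i hi j hj h]
      · rw [hγ2 i hi, hγ3 n hn.le] at h
        exact absurd h (hfE i _ (Or.inr (by omega)))
      · omega
      · omega
      · rw [hγ3 m hm.le, hγ3 n hn.le] at h
        have := hγ.injective h
        omega
    intro m n h
    rcases le_total m n with hle | hle
    · exact hinj m n hle h
    · exact (hinj n m hle h.symm).symm
  · intro n
    rcases hdec n with hn | ⟨i, hi, rfl⟩ | hn
    · rw [hγ1 n hn.le, hγ1 (n + 1) (by omega)]
      have := (hγ.adj_succ (n₁ - (n + 1))).symm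
      rwa [show n₁ - (n + 1) + 1 = n₁ - n by ring] at this
    · rcases hi.lt_or_eq with hi' | rfl
      · rw [hγ2 i hi]
        have := hγ2 (i + 1) hi'
        rw [Nat.cast_succ] at this
        rw [this]
        exact hfadj i hi'
      · rw [hγ3 i le_rfl, hγ3 (i + 1) (by omega)]
        have := (hγ.adj_succ (-n₁ - (i + 1) + i)).symm
        rwa [show -n₁ - ((i : ℤ) + 1) + i + 1 = -n₁ - i + i by ring] at this
    · rw [hγ3 n hn.le, hγ3 (n + 1) (by omega)]
      have := (hγ.adj_succ (-n₁ - (n + 1) + d)).symm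
      rwa [show -n₁ - (n + 1) + d + 1 = -n₁ - n + d by ring] at this
  · intro m n h
    rcases le_total m n with hle | hle
    · exact Or.inl (hrep m n hle h)
    · exact Or.inr (hrep n m hle h.symm)
  · intro n
    rcases hdec n with hn | ⟨i, hi, rfl⟩ | hn
    · rw [hγ1 n hn.le]
      exact hω _ (Or.inl (by omega))
    · rw [hγ2 i hi]
      exact (hfω i).1
    · rw [hγ3 n hn.le]
      exact hω _ (Or.inr (by omega))

end PlanarLattice

/-! ### Both properties produce a gadget -/

open PlanarLattice

namespace Enhancement

variable {L : PlanarLattice} {φ : Enhancement L}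

/-- The configuration is thinned to `η` so that nothing off the path touches its tails; locality
keeps the enhancement unchanged. -/
theorem hasGadget_of_essential {N : ℤ} (hN : φ.RangeIn N) (h : φ.Essential) : φ.HasGadget N := by
  obtain ⟨i, ω, hω, γ, hγ, hγω⟩ := h
  -- Avoiding the box of size `N + 1` makes the tails not even adjacent to the box of size `N`.
  obtain ⟨n₁, hn₁, hfar⟩ : ∃ n₁ : ℤ, 1 ≤ n₁ ∧ ∀ n, n₁ ≤ n ∨ n ≤ -n₁ → γ n ∉ L.siteBox (N + 1) := by
    have hfin : (γ ⁻¹' L.siteBox (N + 1)).Finite :=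
      (finite_siteBox _).preimage hγ.injective.injOn
    obtain ⟨b, hb⟩ := hfin.bddAbove
    obtain ⟨a, ha⟩ := hfin.bddBelow
    refine ⟨max 1 (max (b + 1) (1 - a)), le_max_left _ _, fun n hn hmem => ?_⟩
    have h1 := hb hmem
    have h2 := ha hmem
    omega
  have hfar' : ∀ n, n₁ ≤ n ∨ n ≤ -n₁ → γ n ∉ L.siteBox N := fun n hn h =>
    hfar n hn (siteBox_mono (by omega) h)
  set η : L.Config := (ω ∩ L.siteBox N) ∪ (ω ∩ Set.range γ) with hη
  have hηω : η ⊆ ω := Set.union_subset Set.inter_subset_left Set.inter_subset_left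
  have hφ : φ.baseFun i η = φ.baseFun i ω := by
    refine (hN i).1 _ _ (Set.ext fun x => ⟨fun h => ⟨hηω h.1, h.2⟩, fun h => ⟨Or.inl h, h.2⟩⟩)
  refine hasGadget_of_joined (i := i) (ω := η) (u := γ (-n₁)) (v := γ n₁) hN
    (hfar' _ (Or.inr le_rfl)) (hfar' _ (Or.inl le_rfl)) ?_ fun hj => hω ?_
  · refine joined_of_path hγ.adj_succ (by omega) fun n _ _ => ?_
    rw [hφ]
    exact (hγω n).elim (fun h => Or.inl (Or.inr ⟨h, n, rfl⟩)) Or.inr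
  · refine (containsPath_of_joined_ends hγ hn₁ (fun n hn => ?_) (fun n hn z hz hnz => ?_)
      hj.symm).mono hηω
    · exact Or.inr ⟨(hγω n).resolve_right fun h => hfar' n hn ((hN i).2 _ h), n, rfl⟩
    · rcases hz with hz | ⟨-, m, rfl⟩
      · exact absurd (mem_siteBox_add_one_of_adj hz.2 hnz.symm) (hfar n (by omega))
      · exact ⟨m, rfl⟩

/-- Without gadgets, enhancement at `x` joins no two open sites outside the box about `x`. -/
theorem joined_of_not_hasGadget {N : ℤ} (hN : φ.RangeIn N) (hg : ¬ φ.HasGadget N) (x : L.Site)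
    {ω : L.Config} {u v : L.Site} (hu : L.translate (-x.1) u ∉ L.siteBox N)
    (hv : L.translate (-x.1) v ∉ L.siteBox N) (h : L.graph.Joined (ω ∪ φ.atSite x ω) u v) :
    L.graph.Joined ω u v := by
  refine joined_of_shift x.1 ?_
  by_contra hcon
  refine hg (hasGadget_of_joined (i := x.2) hN hu hv ((joined_shift x.1 h).mono ?_) hcon)
  rintro y (hy | ⟨z, hz, hzy⟩)
  · exact Or.inl hy
  · rw [← translate_injective _ hzy]
    exact Or.inr hz

theorem atSite_mono (hφ : φ.Monotonic) (x : L.Site) {ω ω' : L.Config} (h : ω ⊆ ω') :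
    φ.atSite x ω ⊆ φ.atSite x ω' :=
  Set.image_mono (hφ _ _ _ fun _ hy => h hy)

theorem hasGadget_of_canCreate (hφ : φ.Monotonic) {N : ℤ} (hN : φ.RangeIn N)
    (h : φ.CanCreateInfiniteCluster) : φ.HasGadget N := by
  classical
  by_contra hg
  obtain ⟨ω, hω, α, hα⟩ := h
  rw [hasInfiniteCluster_iff] at hω hα
  push Not at hω
  obtain ⟨v, hv, hinf⟩ := hα
  -- The activations whose box contains `v`, to which `joined_of_not_hasGadget` does not apply with
  -- end `v`. They are finitely many and are performed at the outset.
  set X₀ : Set L.Site := {x | L.translate (-x.1) v ∈ L.siteBox N} with hX₀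
  have hX₀f : X₀.Finite := by
    refine (finite_cellSites ((finite_cellBox N).image fun c => v.1 - c)).subset fun x hx => ?_
    exact ⟨-x.1 + v.1, hx, by simp⟩
  set ω₁ : L.Config := ω ∪ ⋃ x ∈ X₀, φ.atSite x ω with hω₁
  have hcluster : {u | L.graph.Joined ω₁ v u}.Finite := by
    refine SimpleGraph.Joined.finite_union finite_setOf_adj hω
      (hX₀f.biUnion fun x _ => ?_) v
    exact ((finite_siteBox N).subset ((hN x.2).2 _)).image _
  obtain ⟨K, hK⟩ := exists_subset_siteBox hcluster
  -- In or next to the exterior of the box of size `K + 1`. Excluding neighbours too ensures that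
  -- opening the exterior cannot enlarge the cluster of `v`.
  let bad : L.Site → Prop := fun z => z ∉ L.siteBox (K + 1) ∨
    ∃ y, y ∉ L.siteBox (K + 1) ∧ L.graph.Adj z y
  let η : Finset L.Site → L.Config := fun X => ω₁ ∪ ⋃ x ∈ X, φ.atSite x ω
  have hηmono : ∀ X Y, X ⊆ Y → η X ⊆ η Y := fun X Y h =>
    Set.union_subset_union_right _ (Set.biUnion_subset_biUnion_left h)
  have hcover : ∀ y ∈ φ.enhanced ω α, ∃ X : Finset L.Site, (∀ x ∈ X, x ∉ X₀) ∧ y ∈ η X := by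
    rintro y (hy | hy)
    · exact ⟨∅, by simp, Or.inl (Or.inl hy)⟩
    · simp only [Set.mem_iUnion] at hy
      obtain ⟨x, -, hy⟩ := hy
      by_cases hx : x ∈ X₀
      · exact ⟨∅, by simp, Or.inl (Or.inr (Set.mem_biUnion hx hy))⟩
      · exact ⟨{x}, by simpa using hx, Or.inr (by simpa using hy)⟩
  have hvω₁ : v ∈ ω₁ := by
    rcases hv with hv | hv
    · exact Or.inl hv
    · simp only [Set.mem_iUnion] at hv
      obtain ⟨x, -, y, hy, rfl⟩ := hv
      refine Or.inr (Set.mem_biUnion (x := x) ?_ ⟨y, hy, rfl⟩)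
      simpa [hX₀] using (hN x.2).2 _ hy
  have hmain : ∀ X : Finset L.Site, (∀ x ∈ X, x ∉ X₀) → ∀ z, L.graph.Joined (η X) v z → ¬ bad z := by
    intro X
    induction X using Finset.induction_on with
    | empty =>
      rintro - z hz
      have hzK : z ∈ L.siteBox K := hK (by simpa [η] using hz)
      rintro (h | ⟨y, hy, hzy⟩)
      · exact h (siteBox_mono (by omega) hzK)
      · exact hy (mem_siteBox_add_one_of_adj hzK hzy)
    | insert x X hxX ih =>
      intro hX z hz hbad
      have ih := ih fun y hy => hX y (Finset.mem_insert_of_mem hy)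
      have hxv : L.translate (-x.1) v ∉ L.siteBox N := hX x (Finset.mem_insert_self _ _)
      -- With the exterior `F` open, a bad site in the cluster of `v` is linked to some `w` outside
      -- the box about `x`. The activation at `x` cannot have joined `v` to `w`, so they are joined
      -- in `η X ∪ F`; by induction the cluster of `v` in `η X` does not touch `F`, a contradiction.
      set F : L.Config := (L.siteBox (K + 1))ᶜ with hF
      obtain ⟨J, hJ⟩ : ∃ J : ℤ, ∀ y, y ∉ L.siteBox J → L.translate (-x.1) y ∉ L.siteBox N := by
        refine ⟨N + x.1.1.natAbs + x.1.2.natAbs, fun y hy h => hy ?_⟩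
        simp only [siteBox, cellSites, cellBox, Set.mem_ofPred_eq, translate_fst, Prod.fst_add,
          Prod.snd_add, Prod.fst_neg, Prod.snd_neg] at h ⊢
        omega
      have hsub : η (insert x X) ⊆ η X ∪ φ.atSite x (η X) := by
        rintro y (hy | hy)
        · exact Or.inl (Or.inl hy)
        · simp only [Set.mem_iUnion, Finset.mem_insert] at hy
          obtain ⟨x', rfl | hx', hy⟩ := hy
          · exact Or.inr (atSite_mono hφ _ (fun _ h => Or.inl (Or.inl h)) hy)
          · exact Or.inl (Or.inr (Set.mem_biUnion (s := (X : Set L.Site)) hx' hy))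
      obtain ⟨w, hwF, hwJ, hzw⟩ : ∃ w, w ∈ F ∧ w ∉ L.siteBox J ∧
          L.graph.Joined (F ∪ {z}) z w := by
        rcases hbad with hz | ⟨y, hy, hzy⟩
        · obtain ⟨w, h1, h2, h3⟩ := exists_joined_compl_siteBox hz J
          exact ⟨w, h1, h2, h3.mono Set.subset_union_left⟩
        · obtain ⟨w, h1, h2, h3⟩ := exists_joined_compl_siteBox hy J
          exact ⟨w, h1, h2, (SimpleGraph.Joined.of_adj hzy (by simp) (Or.inl hy)).trans
            (h3.mono Set.subset_union_left)⟩
      have hsub' : η (insert x X) ⊆ (η X ∪ F) ∪ φ.atSite x (η X ∪ F) := fun y hy =>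
        (hsub hy).elim (fun h => Or.inl (Or.inl h))
          fun h => Or.inr (atSite_mono hφ _ Set.subset_union_left h)
      have hvw : L.graph.Joined (η X ∪ F) v w := by
        refine joined_of_not_hasGadget hN hg x hxv (hJ w hwJ) ((hz.mono hsub').trans (hzw.mono ?_))
        rintro y (hy | rfl)
        · exact Or.inl (Or.inr hy)
        · exact hsub' (hz.mem (Or.inl hvω₁))
      have hvw' : L.graph.Joined (η X) v w := by
        refine hvw.mem_of_closed (U := {y | L.graph.Joined (η X) v y})
          (SimpleGraph.Reachable.refl _) fun y y' hy hyy' _ hy' => ?_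
        rcases hy' with hy' | hy'
        · exact SimpleGraph.Reachable.trans hy
            (SimpleGraph.Joined.of_adj hyy' (SimpleGraph.Joined.mem hy (Or.inl hvω₁)) hy')
        · exact absurd (Or.inr ⟨y', hy', hyy'⟩) (ih y hy)
      exact ih w hvw' (Or.inl hwF)
  refine hinf ((finite_siteBox (K + 1)).subset fun z hz => ?_)
  -- A finite path uses only finitely many activations, so the induction over finite sets suffices.
  obtain ⟨X, hX, hXz⟩ : ∃ X : Finset L.Site, (∀ x ∈ X, x ∉ X₀) ∧ L.graph.Joined (η X) v z := by
    refine SimpleGraph.Joined.induction (P := fun z => ∃ X : Finset L.Site, (∀ x ∈ X, x ∉ X₀) ∧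
      L.graph.Joined (η X) v z) hz ⟨∅, by simp, SimpleGraph.Reachable.refl _⟩ ?_
    rintro y z ⟨X, hX, hXy⟩ hyz hy hz
    obtain ⟨Y, hY, hyY⟩ := hcover y hy
    obtain ⟨Z, hZ, hzZ⟩ := hcover z hz
    refine ⟨X ∪ Y ∪ Z, fun x hx => ?_, ?_⟩
    · simp only [Finset.mem_union] at hx
      rcases hx with (hx | hx) | hx
      · exact hX x hx
      · exact hY x hx
      · exact hZ x hx
    · refine (hXy.mono (hηmono _ _ fun x hx => by simp [hx])).trans (SimpleGraph.Joined.of_adj hyz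
        (hηmono Y _ (fun x hx => by simp [hx]) hyY) (hηmono Z _ (fun x hx => by simp [hx]) hzZ))
  by_contra hzK
  exact hmain X hX z hXz (Or.inl hzK)

end Enhancement

/-! ### Routing the arms through cells -/

namespace PlanarLattice

variable {L : PlanarLattice}

/-- Finite sets of cells that connect the cells `c` and `d` on the boundary of a box to those of a
translate of the box, with the translates separated from each other. -/
def CellRouting (M : ℤ) (c d : ℤ × ℤ) : Prop :=
  ∃ (A B : Set (ℤ × ℤ)) (w e T : ℤ × ℤ), A.Finite ∧ B.Finite ∧ c ∈ A ∧ d ∈ B ∧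
    cellGraph.Joined A c w ∧ cellGraph.Joined B d e ∧
    (∀ a ∈ A, ∀ b ∈ B, ¬ Near a b) ∧
    (∀ a ∈ A, a ∈ cellBox M → a = c) ∧ (∀ b ∈ B, b ∈ cellBox M → b = d) ∧
    IsStep (T + w - e) ∧
    ∀ k : ℤ, k ≠ 0 → ∀ a ∈ cellBox M ∪ A ∪ B, ∀ b ∈ cellBox M ∪ A ∪ B, Near a (k • T + b) →
      (k = 1 ∧ a = e ∧ b = w) ∨ (k = -1 ∧ a = w ∧ b = e)

theorem CellRouting.of_map {M : ℤ} {c d : ℤ × ℤ} (ψ : (ℤ × ℤ) ≃+ (ℤ × ℤ))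
    (hnear : ∀ a b, Near (ψ a) (ψ b) ↔ Near a b) (hstep : ∀ s, IsStep (ψ s) ↔ IsStep s)
    (hbox : ∀ a, ψ a ∈ cellBox M ↔ a ∈ cellBox M) (h : CellRouting M (ψ c) (ψ d)) :
    CellRouting M c d := by
  obtain ⟨A, B, w, e, T, hA, hB, hc, hd, hcw, hde, hAB, hAM, hBM, hT, hk⟩ := h
  have hj : ∀ {S : Set (ℤ × ℤ)} {a b : ℤ × ℤ}, cellGraph.Joined S (ψ a) b →
      cellGraph.Joined (ψ ⁻¹' S) a (ψ.symm b) := by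
    intro S a b h
    have := SimpleGraph.Joined.map (H := cellGraph) (T := ψ ⁻¹' S) ψ.symm
      (fun y z hyz hy hz => SimpleGraph.Joined.of_adj (show IsStep (ψ.symm z - ψ.symm y) by
        rw [← map_sub, ← hstep, AddEquiv.apply_symm_apply]
        exact hyz) (by simpa using hy) (by simpa using hz)) h
    simpa using this
  refine ⟨ψ ⁻¹' A, ψ ⁻¹' B, ψ.symm w, ψ.symm e, ψ.symm T, hA.preimage ψ.injective.injOn,
    hB.preimage ψ.injective.injOn, hc, hd, hj hcw, hj hde,
    fun a ha b hb h => hAB _ ha _ hb ((hnear a b).2 h),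
    fun a ha h => ψ.injective (hAM _ ha ((hbox a).2 h)),
    fun b hb h => ψ.injective (hBM _ hb ((hbox b).2 h)),
    by rwa [← hstep, map_sub, map_add, AddEquiv.apply_symm_apply, AddEquiv.apply_symm_apply,
      AddEquiv.apply_symm_apply], ?_⟩
  intro k hk0 a ha b hb hab
  have hU : ∀ a, a ∈ cellBox M ∪ ψ ⁻¹' A ∪ ψ ⁻¹' B → ψ a ∈ cellBox M ∪ A ∪ B := by
    rintro a ((ha | ha) | ha)
    · exact Or.inl (Or.inl ((hbox a).2 ha))
    · exact Or.inl (Or.inr ha)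
    · exact Or.inr ha
  have := hk k hk0 _ (hU a ha) _ (hU b hb) (by
    rw [← hnear, map_add, map_zsmul, AddEquiv.apply_symm_apply] at hab
    exact hab)
  rcases this with ⟨h1, h2, h3⟩ | ⟨h1, h2, h3⟩
  · exact Or.inl ⟨h1, by rw [← h2, AddEquiv.symm_apply_apply], by rw [← h3, AddEquiv.symm_apply_apply]⟩
  · exact Or.inr ⟨h1, by rw [← h2, AddEquiv.symm_apply_apply], by rw [← h3, AddEquiv.symm_apply_apply]⟩

/-- The boundary of the box of radius `R`, without the cells of its right side next to height `b`. -/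
def cutRing (R b : ℤ) : Set (ℤ × ℤ) :=
  {z | (-R ≤ z.1 ∧ z.1 ≤ R ∧ -R ≤ z.2 ∧ z.2 ≤ R) ∧ (z.1 = R ∨ z.1 = -R ∨ z.2 = R ∨ z.2 = -R) ∧
    (z.1 < R ∨ z.2 ≤ b - 2 ∨ b + 2 ≤ z.2)}

/-- The cut removes three consecutive cells from the right side; the bounds on `b` keep both right
corners, so what remains runs around to the left side either way. -/
theorem joined_cutRing {R b : ℤ} (hb : -R + 2 ≤ b) (hb' : b ≤ R - 2) {z : ℤ × ℤ}
    (hz : z ∈ cutRing R b) : cellGraph.Joined (cutRing R b) z (-R, b) := by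
  have bottomLeft : cellGraph.Joined (cutRing R b) (-R, -R) (-R, b) :=
    joined_vertical (by omega) fun t h1 h2 => by
      simp only [cutRing, Set.mem_ofPred_eq, or_true, true_or, true_and]
      omega
  have topLeft : cellGraph.Joined (cutRing R b) (-R, R) (-R, b) :=
    (joined_vertical (by omega) fun t h1 h2 => by
      simp only [cutRing, Set.mem_ofPred_eq, or_true, true_or, true_and]
      omega).symm
  have bottom : ∀ x, -R ≤ x → x ≤ R → cellGraph.Joined (cutRing R b) (x, -R) (-R, b) :=
    fun x h h' => SimpleGraph.Reachable.trans ((joined_horizontal h fun t h1 h2 => by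
      simp only [cutRing, Set.mem_ofPred_eq, or_true, true_and]
      omega).symm) bottomLeft
  have top : ∀ x, -R ≤ x → x ≤ R → cellGraph.Joined (cutRing R b) (x, R) (-R, b) :=
    fun x h h' => SimpleGraph.Reachable.trans ((joined_horizontal h fun t h1 h2 => by
      simp only [cutRing, Set.mem_ofPred_eq, or_true, true_or, true_and]
      omega).symm) topLeft
  obtain ⟨x, y⟩ := z
  simp only [cutRing, Set.mem_ofPred_eq] at hz
  obtain ⟨⟨h1, h2, h3, h4⟩, h5, h6⟩ := hz
  rcases h5 with rfl | rfl | rfl | rfl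
  · rcases (by omega : b + 2 ≤ y ∨ y ≤ b - 2) with h | h
    · refine SimpleGraph.Reachable.trans (joined_vertical h4 fun t h7 h8 => ?_) (top x (by omega) le_rfl)
      simp only [cutRing, Set.mem_ofPred_eq, true_or, true_and]
      omega
    · refine SimpleGraph.Reachable.trans (joined_vertical h3 fun t h7 h8 => ?_).symm
        (bottom x (by omega) le_rfl)
      simp only [cutRing, Set.mem_ofPred_eq, true_or, true_and]
      omega
  · rcases le_total y b with h | h
    · refine joined_vertical h fun t h7 h8 => ?_
      simp only [cutRing, Set.mem_ofPred_eq, or_true, true_or, true_and]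
      omega
    · refine (joined_vertical h fun t h7 h8 => ?_).symm
      simp only [cutRing, Set.mem_ofPred_eq, or_true, true_or, true_and]
      omega
  · exact top x h1 h2
  · exact bottom x h1 h2

/-- The arm of `d` runs straight to the right through the gap of the cut ring. The arm of `c` steps
out to the ring, follows it round to the left side and continues straight to the left at the same
height `b`. -/
theorem cellRouting_right {M b : ℤ} {c : ℤ × ℤ} (hM : 1 ≤ M) (hb : -M ≤ b ∧ b ≤ M)
    (hc : c ∈ cellBox M) (hc' : c ∉ cellBox (M - 1)) (hcd : ¬ Near c (M, b)) :
    CellRouting M c (M, b) := by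
  obtain ⟨x, y⟩ := c
  simp only [Near, cellBox, Set.mem_ofPred_eq] at hcd hc hc'
  -- Two straight steps lead from `c` across layer `M + 1` to the ring in layer `M + 2`; the
  -- conditions on `s` keep it clear of the other arm.
  obtain ⟨s, r, hcs, hsr, hs, hr⟩ : ∃ s r : ℤ × ℤ, IsStep (s - (x, y)) ∧ IsStep (r - s) ∧
      (-M - 1 ≤ s.1 ∧ s.1 ≤ M + 1 ∧ -M - 1 ≤ s.2 ∧ s.2 ≤ M + 1 ∧
        (s.1 = M + 1 ∧ (b + 2 ≤ s.2 ∨ s.2 ≤ b - 2) ∨ s.1 = -M - 1 ∨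
          ((s.2 = M + 1 ∨ s.2 = - M - 1) ∧ s.1 = x ∧ (x ≤ M - 2 ∨ b + 3 ≤ s.2 ∨ s.2 ≤ b - 3)) ∨
          ((s.2 = M + 1 ∧ b ≤ M - 1 ∨ s.2 = -M - 1 ∧ - M + 1 ≤ b) ∧ s.1 = x ∧ x ≤ M - 1))) ∧
      r ∈ cutRing (M + 2) b := by
    simp only [IsStep, cutRing, Set.mem_ofPred_eq]
    rcases (by omega : x = M ∨ x = -M ∨ y = M ∨ y = -M) with h | h | h | h
    · exact ⟨(x + 1, y), (x + 2, y), by simp, by simp [Prod.ext_iff], by dsimp only; omega,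
        by dsimp only; omega⟩
    · exact ⟨(x - 1, y), (x - 2, y), by simp [Prod.ext_iff], by simp [Prod.ext_iff],
        by dsimp only; omega, by dsimp only; omega⟩
    · exact ⟨(x, y + 1), (x, y + 2), by simp, by simp [Prod.ext_iff], by dsimp only; omega,
        by dsimp only; omega⟩
    · exact ⟨(x, y - 1), (x, y - 2), by simp [Prod.ext_iff], by simp [Prod.ext_iff],
        by dsimp only; omega, by dsimp only; omega⟩
  set A : Set (ℤ × ℤ) := {z | z = (x, y) ∨ z = s ∨ z ∈ cutRing (M + 2) b ∨
    (-M - 4 ≤ z.1 ∧ z.1 ≤ -M - 2 ∧ z.2 = b)} with hA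
  set B : Set (ℤ × ℤ) := {z | M ≤ z.1 ∧ z.1 ≤ M + 4 ∧ z.2 = b} with hB
  have hring : cutRing (M + 2) b ⊆ A := fun z hz => Or.inr (Or.inr (Or.inl hz))
  have hD : ∀ a ∈ cellBox M ∪ A ∪ B, -(M + 4) ≤ a.1 ∧ a.1 ≤ M + 4 ∧ -(M + 4) ≤ a.2 ∧ a.2 ≤ M + 4 ∧
      (a.1 = M + 4 → a = (M + 4, b)) ∧ (a.1 = -M - 4 → a = (-M - 4, b)) := by
    rintro ⟨a, a'⟩ h
    simp only [hA, hB, cutRing, cellBox, Set.mem_ofPred_eq, Set.mem_union, Prod.ext_iff] at h ⊢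
    omega
  have hfin : (cellBox M ∪ A ∪ B).Finite := (finite_cellBox (M + 4)).subset fun a ha =>
    have h := hD a ha
    ⟨h.1, h.2.1, h.2.2.1, h.2.2.2.1⟩
  -- A link occupies the `2 * M + 9` columns from `-M - 4` to `M + 4`, with a single cell in each
  -- extreme column. Translation by this width leaves just one contact between successive links.
  refine ⟨A, B, (-M - 4, b), (M + 4, b), (2 * M + 9, 0),
    hfin.subset fun a ha => Or.inl (Or.inr ha), hfin.subset fun a ha => Or.inr ha,
    Or.inl rfl, ⟨le_rfl, by dsimp only; omega, rfl⟩, ?_, ?_, ?_, ?_, ?_, ?_, ?_⟩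
  · have h1 : cellGraph.Joined A (x, y) s :=
      SimpleGraph.Joined.of_adj hcs (Or.inl rfl) (Or.inr (Or.inl rfl))
    have h2 : cellGraph.Joined A s r :=
      SimpleGraph.Joined.of_adj hsr (Or.inr (Or.inl rfl)) (hring hr)
    have h3 : cellGraph.Joined A r (-(M + 2), b) :=
      (joined_cutRing (by omega) (by omega) hr).mono hring
    have h4 : cellGraph.Joined A (-M - 4, b) (-(M + 2), b) :=
      joined_horizontal (by omega) fun t h5 h6 =>
        Or.inr (Or.inr (Or.inr ⟨h5, by dsimp only; omega, rfl⟩))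
    exact ((h1.trans h2).trans h3).trans h4.symm
  · exact joined_horizontal (by omega) fun t h5 h6 => ⟨h5, h6, rfl⟩
  · rintro ⟨a, a'⟩ ha ⟨u, u'⟩ hu
    simp only [hA, hB, cutRing, Near, Set.mem_ofPred_eq, Prod.ext_iff] at ha hu ⊢
    omega
  · rintro ⟨a, a'⟩ ha ha'
    simp only [hA, cutRing, cellBox, Set.mem_ofPred_eq, Prod.ext_iff] at ha ha' ⊢
    omega
  · rintro ⟨a, a'⟩ ha ha'
    simp only [hB, cellBox, Set.mem_ofPred_eq, Prod.ext_iff] at ha ha' ⊢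
    omega
  · left
    simp [Prod.ext_iff]
    ring
  · intro k hk a ha u hu hau
    have h1 := hD a ha
    have h2 := hD u hu
    simp only [Near, Prod.fst_add, Prod.smul_mk, smul_eq_mul] at hau
    rcases (by omega : k = 1 ∨ k = -1 ∨ 2 ≤ k ∨ k ≤ -2) with rfl | rfl | hk | hk
    · exact Or.inl ⟨rfl, h1.2.2.2.2.1 (by omega), h2.2.2.2.2.2 (by omega)⟩
    · exact Or.inr ⟨rfl, h1.2.2.2.2.2 (by omega), h2.2.2.2.2.1 (by omega)⟩
    · exfalso
      have : 2 * (2 * M + 9) ≤ k * (2 * M + 9) := by nlinarith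
      omega
    · exfalso
      have : k * (2 * M + 9) ≤ -2 * (2 * M + 9) := by nlinarith
      omega

/-- Reduction to `d` on the right side by the point reflection and the exchange of coordinates. Both
preserve `Near`; a reflection in one coordinate axis would not, because of its diagonal direction.
-/
theorem exists_cellRouting {M : ℤ} {c d : ℤ × ℤ} (hM : 1 ≤ M) (hc : c ∈ cellBox M)
    (hc' : c ∉ cellBox (M - 1)) (hd : d ∈ cellBox M) (hd' : d ∉ cellBox (M - 1))
    (hcd : ¬ Near c d) : CellRouting M c d := by
  have right : ∀ c d : ℤ × ℤ, c ∈ cellBox M → c ∉ cellBox (M - 1) → d ∈ cellBox M → d.1 = M →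
      ¬ Near c d → CellRouting M c d := by
    rintro c ⟨_, b⟩ hc hc' hd rfl hcd
    exact cellRouting_right hM ⟨hd.2.2.1, hd.2.2.2⟩ hc hc' hcd
  have hneg : ∀ N a, -a ∈ cellBox N ↔ a ∈ cellBox N := fun N a => by
    simp only [cellBox, Set.mem_ofPred_eq, Prod.fst_neg, Prod.snd_neg]
    omega
  have hnegN : ∀ a b, Near (-a) (-b) ↔ Near a b := fun a b => by
    simp only [Near, Prod.fst_neg, Prod.snd_neg]
    omega
  have horizontal : ∀ c d : ℤ × ℤ, c ∈ cellBox M → c ∉ cellBox (M - 1) → d ∈ cellBox M →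
      (d.1 = M ∨ d.1 = -M) → ¬ Near c d → CellRouting M c d := by
    rintro c d hc hc' hd (hdM | hdM) hcd
    · exact right c d hc hc' hd hdM hcd
    · refine CellRouting.of_map (AddEquiv.neg (ℤ × ℤ)) hnegN (fun s => ?_) (hneg M) (right (-c) (-d)
        ((hneg M c).2 hc) (fun h => hc' ((hneg _ c).1 h)) ((hneg M d).2 hd) ?_
        fun h => hcd ((hnegN _ _).1 h))
      · simp only [IsStep, AddEquiv.neg_apply, Prod.ext_iff, Prod.fst_neg, Prod.snd_neg]
        omega
      · simp [hdM]
  by_cases hh : d.1 = M ∨ d.1 = -M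
  · exact horizontal c d hc hc' hd hh hcd
  · have hswap : ∀ N (a : ℤ × ℤ), a.swap ∈ cellBox N ↔ a ∈ cellBox N := fun N a => by
      simp only [cellBox, Set.mem_ofPred_eq, Prod.fst_swap, Prod.snd_swap]
      omega
    have hswapN : ∀ a b : ℤ × ℤ, Near a.swap b.swap ↔ Near a b := fun a b => by
      simp only [Near, Prod.fst_swap, Prod.snd_swap]
      omega
    refine CellRouting.of_map AddEquiv.prodComm hswapN (fun s => ?_) (hswap M)
      (horizontal c.swap d.swap ((hswap M c).2 hc) (fun h => hc' ((hswap _ c).1 h))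
        ((hswap M d).2 hd) ?_ fun h => hcd ((hswapN _ _).1 h))
    · change IsStep s.swap ↔ _
      simp only [IsStep, Prod.ext_iff, Prod.fst_swap, Prod.snd_swap]
      omega
    · simp only [cellBox, Set.mem_ofPred_eq] at hd hd'
      simp only [Prod.fst_swap]
      omega

end PlanarLattice

/-! ### Leaving the box, and the routing of sites -/

namespace PlanarLattice

variable {L : PlanarLattice}

/-- A way from the exit `p` of a box through the site `s` to the cell `c`, two layers outside. -/
structure ExitStep (L : PlanarLattice) (N : ℤ) (p s : L.Site) (c : ℤ × ℤ) : Prop where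
  step : s = p ∨ L.graph.Adj p s
  adj_cell : ∃ x : L.Site, x.1 = c ∧ L.graph.Adj s x
  mem : s ∈ L.siteBox (N + 1)
  notMem : s ∉ L.siteBox N
  eq_of_adj : ∀ f ∈ L.siteBox N, L.graph.Adj s f → s = p
  cell_mem : c ∈ cellBox (N + 2)
  cell_notMem : c ∉ cellBox (N + 1)

/-- The ways from two exits do not touch each other. -/
structure ExitSeparated (L : PlanarLattice) (p s q s' : L.Site) (c d : ℤ × ℤ) : Prop where
  ne : ∀ x, x = p ∨ x = s → ∀ y, y = q ∨ y = s' → x ≠ y ∧ ¬ L.graph.Adj x y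
  not_near_right : ∀ x, x = p ∨ x = s → ¬ Near x.1 d
  not_near_left : ∀ y, y = q ∨ y = s' → ¬ Near c y.1
  not_near : ¬ Near c d

/-- The cell `c` is the cell two layers outside the box that is next to the cell `p`. -/
def IsOutward (N : ℤ) (p c : ℤ × ℤ) : Prop :=
  (-N - 1 ≤ p.1 ∧ p.1 ≤ N + 1 ∧ -N - 1 ≤ p.2 ∧ p.2 ≤ N + 1) ∧
  ((p.1 = N + 1 ∧ c = (N + 2, p.2)) ∨ (p.1 = -N - 1 ∧ c = (-N - 2, p.2)) ∨
    (p.2 = N + 1 ∧ c = (p.1, N + 2)) ∨ (p.2 = -N - 1 ∧ c = (p.1, -N - 2)))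

theorem IsExit.mem {N : ℤ} {p : L.Site} (hp : L.IsExit N p) : p ∈ L.siteBox (N + 1) := by
  obtain ⟨-, f, hf, hpf⟩ := hp
  exact mem_siteBox_add_one_of_adj hf hpf.symm

theorem IsExit.exists_isOutward {N : ℤ} {p : L.Site} (hp : L.IsExit N p) :
    ∃ c, IsOutward N p.1 c := by
  have h1 := hp.mem
  have h2 := hp.1
  simp only [siteBox, cellSites, cellBox, Set.mem_ofPred_eq] at h1 h2
  simp only [IsOutward]
  rcases (by omega : p.1.1 = N + 1 ∨ p.1.1 = -N - 1 ∨ p.1.2 = N + 1 ∨ p.1.2 = -N - 1)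
    with h | h | h | h
  · exact ⟨_, by omega, Or.inl ⟨h, rfl⟩⟩
  · exact ⟨_, by omega, Or.inr (Or.inl ⟨h, rfl⟩)⟩
  · exact ⟨_, by omega, Or.inr (Or.inr (Or.inl ⟨h, rfl⟩))⟩
  · exact ⟨_, by omega, Or.inr (Or.inr (Or.inr ⟨h, rfl⟩))⟩

theorem IsOutward.exitStep {N : ℤ} {p : L.Site} {c : ℤ × ℤ} (hp : L.IsExit N p) (hN : 0 ≤ N)
    (h : IsOutward N p.1 c) (hL : ∀ x y : L.Site, IsStep (y.1 - x.1) → L.graph.Adj x y) :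
    ExitStep L N p p c where
  step := Or.inl rfl
  adj_cell := ⟨(c, p.2), rfl, hL _ _ (by
    simp only [IsOutward, IsStep, Prod.ext_iff, Prod.fst_sub, Prod.snd_sub] at h ⊢
    omega)⟩
  mem := hp.mem
  notMem := hp.1
  eq_of_adj _ _ _ := rfl
  cell_mem := by
    simp only [IsOutward, cellBox, Set.mem_ofPred_eq, Prod.ext_iff] at h ⊢
    omega
  cell_notMem := by
    simp only [IsOutward, cellBox, Set.mem_ofPred_eq, Prod.ext_iff] at h ⊢
    omega

/-- Distinct cells of the layer around the box that are not a unit step apart can be `Near` only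
across a corner, and moving outwards separates them there. -/
theorem IsOutward.not_near {N : ℤ} (hN : 0 ≤ N) {p q c d : ℤ × ℤ} (hp : IsOutward N p c)
    (hq : IsOutward N q d) (hpq : p ≠ q) (hstep : ¬ IsStep (q - p)) :
    ¬ Near p d ∧ ¬ Near c q ∧ ¬ Near c d := by
  obtain ⟨p1, p2⟩ := p
  obtain ⟨q1, q2⟩ := q
  obtain ⟨c1, c2⟩ := c
  obtain ⟨d1, d2⟩ := d
  simp only [IsStep, Prod.mk_sub_mk, Prod.mk.injEq, ne_eq] at hpq hstep
  obtain ⟨hp0, hp⟩ := hp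
  obtain ⟨hq0, hq⟩ := hq
  simp only [Near, Prod.mk.injEq] at *
  rcases hp with hp | hp | hp | hp <;> rcases hq with hq | hq | hq | hq <;> omega

theorem exists_exitSteps_of_unique {N : ℤ} (hN : 0 ≤ N) {p q : L.Site} (hp : L.IsExit N p)
    (hq : L.IsExit N q) (hpq : p ≠ q) (hadj : ¬ L.graph.Adj p q)
    (hL : ∀ x y : L.Site, IsStep (y.1 - x.1) → L.graph.Adj x y)
    (huniq : ∀ x y : L.Site, x.1 = y.1 → x = y) :
    ∃ s c s' d, ExitStep L N p s c ∧ ExitStep L N q s' d ∧ ExitSeparated L p s q s' c d := by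
  obtain ⟨c, hc⟩ := hp.exists_isOutward
  obtain ⟨d, hd⟩ := hq.exists_isOutward
  obtain ⟨h1, h2, h3⟩ := hc.not_near hN hd (fun h => hpq (huniq _ _ h)) fun h => hadj (hL _ _ h)
  refine ⟨p, c, q, d, hc.exitStep hp hN hL, hd.exitStep hq hN hL, ⟨?_, ?_, ?_, h3⟩⟩
  · rintro x (rfl | rfl) y (rfl | rfl) <;> exact ⟨hpq, hadj⟩
  · rintro x (rfl | rfl) <;> exact h1
  · rintro x (rfl | rfl) <;> exact h2

/-- The orbit of a site of the hexagonal lattice, as a number. -/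
def orbitNum (x : hexagonal.Site) : ℤ := cond x.2 1 0

theorem hexagonal_adj (x y : hexagonal.Site) : hexagonal.graph.Adj x y ↔
    (orbitNum x = 0 ∧ orbitNum y = 1 ∧ (y.1.1 = x.1.1 ∧ y.1.2 = x.1.2 ∨
      y.1.1 = x.1.1 - 1 ∧ y.1.2 = x.1.2 ∨ y.1.1 = x.1.1 ∧ y.1.2 = x.1.2 - 1)) ∨
    (orbitNum x = 1 ∧ orbitNum y = 0 ∧ (y.1.1 = x.1.1 ∧ y.1.2 = x.1.2 ∨
      y.1.1 = x.1.1 + 1 ∧ y.1.2 = x.1.2 ∨ y.1.1 = x.1.1 ∧ y.1.2 = x.1.2 + 1)) := by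
  obtain ⟨⟨a, b⟩, i⟩ := x
  obtain ⟨⟨a', b'⟩, j⟩ := y
  have h := @graph_adj_hexagonal (a, b) (a', b') i j
  refine h.trans ?_
  simp only [Prod.mk_sub_mk, Prod.mk.injEq]
  change Bool at i j
  cases i <;> cases j <;> simp [orbitNum] <;> omega

theorem hexagonal_ext {x y : hexagonal.Site} (h1 : x.1.1 = y.1.1) (h2 : x.1.2 = y.1.2)
    (h3 : orbitNum x = orbitNum y) : x = y := by
  obtain ⟨⟨a, b⟩, i⟩ := x
  obtain ⟨⟨a', b'⟩, j⟩ := y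
  obtain rfl : a = a' := h1
  obtain rfl : b = b' := h2
  change Bool at i j
  cases i <;> cases j <;> first | rfl | simp [orbitNum] at h3

theorem exists_hexagonal_site (a b : ℤ) {n : ℤ} (hn : n = 0 ∨ n = 1) :
    ∃ x : hexagonal.Site, x.1 = (a, b) ∧ orbitNum x = n := by
  rcases hn with rfl | rfl
  · exact ⟨((a, b), false), rfl, rfl⟩
  · exact ⟨((a, b), true), rfl, rfl⟩

/-- The ways out of a box in the hexagonal lattice; `σ` selects one of two ways. -/
def IsHexStep (N σ : ℤ) (p s : hexagonal.Site) (c : ℤ × ℤ) : Prop :=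
  (orbitNum p = 0 ∧ orbitNum s = 1 ∧ p.1.1 = N + 1 ∧ -N ≤ p.1.2 ∧ p.1.2 ≤ N ∧
    s.1.1 = N + 1 ∧ s.1.2 = p.1.2 - 1 + σ ∧ c.1 = N + 2 ∧ c.2 = p.1.2 - 1 + σ) ∨
  (orbitNum p = 0 ∧ orbitNum s = 1 ∧ p.1.2 = N + 1 ∧ -N ≤ p.1.1 ∧ p.1.1 ≤ N ∧
    s.1.2 = N + 1 ∧ s.1.1 = p.1.1 - 1 + σ ∧ c.2 = N + 2 ∧ c.1 = p.1.1 - 1 + σ) ∨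
  (orbitNum p = 1 ∧ orbitNum s = 0 ∧ p.1.1 = -N - 1 ∧ -N ≤ p.1.2 ∧ p.1.2 ≤ N ∧
    s.1.1 = -N - 1 ∧ s.1.2 = p.1.2 + σ ∧ c.1 = -N - 2 ∧ c.2 = p.1.2 + σ) ∨
  (orbitNum p = 1 ∧ orbitNum s = 0 ∧ p.1.2 = -N - 1 ∧ -N ≤ p.1.1 ∧ p.1.1 ≤ N ∧
    s.1.2 = -N - 1 ∧ s.1.1 = p.1.1 + σ ∧ c.2 = -N - 2 ∧ c.1 = p.1.1 + σ)

theorem exists_isHexStep {N : ℤ} (σ : ℤ) {p : hexagonal.Site} (hp : hexagonal.IsExit N p) :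
    ∃ s c, IsHexStep N σ p s c := by
  obtain ⟨h1, f, hf, hpf⟩ := hp
  rw [hexagonal_adj] at hpf
  simp only [siteBox, cellSites, cellBox, Set.mem_ofPred_eq] at h1 hf
  rcases hpf with ⟨h2, -, h | h | h⟩ | ⟨h2, -, h | h | h⟩
  · omega
  · obtain ⟨s, hs, hs'⟩ := exists_hexagonal_site (N + 1) (p.1.2 - 1 + σ) (Or.inr rfl)
    exact ⟨s, (N + 2, p.1.2 - 1 + σ), Or.inl
      ⟨h2, hs', by omega, by omega, by omega, by rw [hs], by rw [hs], rfl, rfl⟩⟩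
  · obtain ⟨s, hs, hs'⟩ := exists_hexagonal_site (p.1.1 - 1 + σ) (N + 1) (Or.inr rfl)
    exact ⟨s, (p.1.1 - 1 + σ, N + 2), Or.inr (Or.inl
      ⟨h2, hs', by omega, by omega, by omega, by rw [hs], by rw [hs], rfl, rfl⟩)⟩
  · omega
  · obtain ⟨s, hs, hs'⟩ := exists_hexagonal_site (-N - 1) (p.1.2 + σ) (Or.inl rfl)
    exact ⟨s, (-N - 2, p.1.2 + σ), Or.inr (Or.inr (Or.inl
      ⟨h2, hs', by omega, by omega, by omega, by rw [hs], by rw [hs], rfl, rfl⟩))⟩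
  · obtain ⟨s, hs, hs'⟩ := exists_hexagonal_site (p.1.1 + σ) (-N - 1) (Or.inl rfl)
    exact ⟨s, (p.1.1 + σ, -N - 2), Or.inr (Or.inr (Or.inr
      ⟨h2, hs', by omega, by omega, by omega, by rw [hs], by rw [hs], rfl, rfl⟩))⟩

theorem IsHexStep.exitStep {N σ : ℤ} (hN : 0 ≤ N) (hσ : σ = 0 ∨ σ = 1) {p s : hexagonal.Site}
    {c : ℤ × ℤ} (h : IsHexStep N σ p s c) : ExitStep hexagonal N p s c where
  step := by
    right
    rw [hexagonal_adj]
    rcases h with h | h | h | h <;> omega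
  adj_cell := by
    have h0 : orbitNum s = 0 ∨ orbitNum s = 1 := by
      simp only [IsHexStep] at h
      omega
    obtain ⟨x, hx, hx'⟩ := exists_hexagonal_site c.1 c.2 (n := 1 - orbitNum s) (by omega)
    refine ⟨x, hx, (hexagonal_adj s x).2 ?_⟩
    rw [hx]
    rcases h with h | h | h | h <;> omega
  mem := by
    simp only [siteBox, cellSites, cellBox, Set.mem_ofPred_eq]
    rcases h with h | h | h | h <;> omega
  notMem := by
    simp only [siteBox, cellSites, cellBox, Set.mem_ofPred_eq]
    rcases h with h | h | h | h <;> omega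
  eq_of_adj f hf hsf := by
    exfalso
    rw [hexagonal_adj] at hsf
    simp only [siteBox, cellSites, cellBox, Set.mem_ofPred_eq] at hf
    rcases h with h | h | h | h <;> omega
  cell_mem := by
    simp only [cellBox, Set.mem_ofPred_eq]
    rcases h with h | h | h | h <;> omega
  cell_notMem := by
    simp only [cellBox, Set.mem_ofPred_eq]
    rcases h with h | h | h | h <;> omega

theorem IsHexStep.orbitNum_eq {N σ : ℤ} (hN : 0 ≤ N) {p s : hexagonal.Site} {c : ℤ × ℤ}
    (h : IsHexStep N σ p s c) : (p.1.1 = N + 1 → orbitNum p = 0) ∧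
      (p.1.1 = -N - 1 → orbitNum p = 1) ∧ (p.1.2 = N + 1 → orbitNum p = 0) ∧
      (p.1.2 = -N - 1 → orbitNum p = 1) := by
  refine ⟨fun h' => ?_, fun h' => ?_, fun h' => ?_, fun h' => ?_⟩ <;>
    rcases h with h | h | h | h <;> omega

/-- The two sites lie on the same side of the box, `p` coming first. -/
def SameSideLt (N : ℤ) (p q : ℤ × ℤ) : Prop :=
  p.1 = q.1 ∧ (p.1 = N + 1 ∨ p.1 = -N - 1) ∧ p.2 < q.2 ∨
    p.2 = q.2 ∧ (p.2 = N + 1 ∨ p.2 = -N - 1) ∧ p.1 < q.1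

/-- The two sites lie on different sides of the box. -/
def DifferentSides (N : ℤ) (p q : ℤ × ℤ) : Prop :=
  (¬ (p.1 = N + 1 ∧ q.1 = N + 1) ∧ ¬ (p.1 = -N - 1 ∧ q.1 = -N - 1)) ∧
    (¬ (p.2 = N + 1 ∧ q.2 = N + 1) ∧ ¬ (p.2 = -N - 1 ∧ q.2 = -N - 1))

-- With `σ = 0` the ways out of the right and the top side both bend away from the corner they
-- share; the other corners leave enough room.
set_option maxHeartbeats 1000000 in
theorem IsHexStep.separated_of_differentSides {N : ℤ} (hN : 0 ≤ N) {p s q s' : hexagonal.Site}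
    {c d : ℤ × ℤ} (hp : IsHexStep N 0 p s c) (hq : IsHexStep N 0 q s' d)
    (h : DifferentSides N p.1 q.1) : ExitSeparated hexagonal p s q s' c d := by
  obtain ⟨⟨h₁, h₂⟩, h₃, h₄⟩ := h
  rcases hp with hp | hp | hp | hp <;> rcases hq with hq | hq | hq | hq
  all_goals
    first
    | exact (h₁ ⟨hp.2.2.1, hq.2.2.1⟩).elim
    | exact (h₂ ⟨hp.2.2.1, hq.2.2.1⟩).elim
    | exact (h₃ ⟨hp.2.2.1, hq.2.2.1⟩).elim
    | exact (h₄ ⟨hp.2.2.1, hq.2.2.1⟩).elim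
    | clear h₁ h₂ h₃ h₄
  all_goals
    refine ⟨?_, ?_, ?_, ?_⟩
    · rintro x hx y hy
      refine ⟨fun hxy => ?_, fun hxy => ?_⟩
      · subst hxy
        rcases hx with rfl | rfl <;> rcases hy with hy | hy <;> subst hy <;> omega
      · rw [hexagonal_adj] at hxy
        rcases hx with rfl | rfl <;> rcases hy with rfl | rfl <;>
          rcases hxy with ⟨h1, h2, h3⟩ | ⟨h1, h2, h3⟩ <;> omega
    · rintro x (rfl | rfl) <;> simp only [Near] <;> omega
    · rintro x (rfl | rfl) <;> simp only [Near] <;> omega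
    · simp only [Near]
      omega

-- The choices `σ = 0` for the first exit and `σ = 1` for the second make the ways diverge, so that
-- even exits in consecutive cells lead to cells two apart.
set_option maxHeartbeats 1000000 in
theorem IsHexStep.separated_of_sameSideLt {N : ℤ} (hN : 0 ≤ N) {p s q s' : hexagonal.Site}
    {c d : ℤ × ℤ} (hp : IsHexStep N 0 p s c) (hq : IsHexStep N 1 q s' d)
    (h : SameSideLt N p.1 q.1) : ExitSeparated hexagonal p s q s' c d := by
  rcases h with ⟨e, e' | e', h⟩ | ⟨e, e' | e', h⟩ <;> rcases hp with hp | hp | hp | hp <;>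
    try (exfalso; clear hq; omega)
  all_goals
    rcases hq with hq | hq | hq | hq <;> try (exfalso; omega)
  all_goals
    refine ⟨?_, ?_, ?_, ?_⟩
    · rintro x hx y hy
      refine ⟨fun hxy => ?_, fun hxy => ?_⟩
      · subst hxy
        rcases hx with rfl | rfl <;> rcases hy with hy | hy <;> subst hy <;> omega
      · rw [hexagonal_adj] at hxy
        rcases hx with rfl | rfl <;> rcases hy with rfl | rfl <;>
          rcases hxy with ⟨h1, h2, h3⟩ | ⟨h1, h2, h3⟩ <;> omega
    · rintro x (rfl | rfl) <;> simp only [Near] <;> omega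
    · rintro x (rfl | rfl) <;> simp only [Near] <;> omega
    · simp only [Near]
      omega

theorem ExitSeparated.symm {p s q s' : L.Site} {c d : ℤ × ℤ} (h : ExitSeparated L p s q s' c d) :
    ExitSeparated L q s' p s d c := by
  have hN : ∀ a b, Near a b → Near b a := fun a b h => by
    simp only [Near] at h ⊢
    omega
  exact ⟨fun x hx y hy => ⟨(h.ne y hy x hx).1.symm, fun h' => (h.ne y hy x hx).2 h'.symm⟩,
    fun x hx h' => h.not_near_left x hx (hN _ _ h'), fun x hx h' => h.not_near_right x hx (hN _ _ h'),
    fun h' => h.not_near (hN _ _ h')⟩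

theorem exists_exitSteps_hexagonal {N : ℤ} (hN : 0 ≤ N) {p q : hexagonal.Site}
    (hp : hexagonal.IsExit N p) (hq : hexagonal.IsExit N q) (hpq : p ≠ q) :
    ∃ s c s' d, ExitStep hexagonal N p s c ∧ ExitStep hexagonal N q s' d ∧
      ExitSeparated hexagonal p s q s' c d := by
  obtain ⟨s₀, c₀, h₀⟩ := exists_isHexStep 0 hp
  obtain ⟨s₁, c₁, h₁⟩ := exists_isHexStep 1 hp
  obtain ⟨t₀, d₀, k₀⟩ := exists_isHexStep 0 hq
  obtain ⟨t₁, d₁, k₁⟩ := exists_isHexStep 1 hq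
  have hcase : DifferentSides N p.1 q.1 ∨ SameSideLt N p.1 q.1 ∨ SameSideLt N q.1 p.1 := by
    have hne : ¬ (p.1.1 = q.1.1 ∧ p.1.2 = q.1.2 ∧ orbitNum p = orbitNum q) := fun h =>
      hpq (hexagonal_ext h.1 h.2.1 h.2.2)
    obtain ⟨h1, h2, h3, h4⟩ := h₀.orbitNum_eq hN
    obtain ⟨h5, h6, h7, h8⟩ := k₀.orbitNum_eq hN
    clear h₀ h₁ k₀ k₁
    by_cases hD : DifferentSides N p.1 q.1
    · exact Or.inl hD
    · right
      rw [DifferentSides, not_and_or] at hD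
      simp only [SameSideLt]
      rcases hD with hD | hD
      · have e : p.1.1 = q.1.1 := by omega
        rcases (by omega : p.1.1 = N + 1 ∨ p.1.1 = -N - 1) with h | h <;> omega
      · have e : p.1.2 = q.1.2 := by omega
        rcases (by omega : p.1.2 = N + 1 ∨ p.1.2 = -N - 1) with h | h <;> omega
  rcases hcase with h | h | h
  · exact ⟨s₀, c₀, t₀, d₀, h₀.exitStep hN (Or.inl rfl), k₀.exitStep hN (Or.inl rfl),
      h₀.separated_of_differentSides hN k₀ h⟩
  · exact ⟨s₀, c₀, t₁, d₁, h₀.exitStep hN (Or.inl rfl), k₁.exitStep hN (Or.inr rfl),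
      h₀.separated_of_sameSideLt hN k₁ h⟩
  · exact ⟨s₁, c₁, t₀, d₀, h₁.exitStep hN (Or.inr rfl), k₀.exitStep hN (Or.inl rfl),
      (k₀.separated_of_sameSideLt hN h₁ h).symm⟩

theorem exists_exitSteps {N : ℤ} (hN : 0 ≤ N) {p q : L.Site} (hp : L.IsExit N p)
    (hq : L.IsExit N q) (hpq : p ≠ q) (hadj : ¬ L.graph.Adj p q) :
    ∃ s c s' d, ExitStep L N p s c ∧ ExitStep L N q s' d ∧ ExitSeparated L p s q s' c d := by
  cases L
  · exact exists_exitSteps_of_unique hN hp hq hpq hadj (fun x y h => graph_adj_square.2 h)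
      fun x y h => Prod.ext h rfl
  · exact exists_exitSteps_of_unique hN hp hq hpq hadj
      (fun x y h => graph_adj_triangular.2 (Or.inl h)) fun x y h => Prod.ext h rfl
  · exact exists_exitSteps_hexagonal hN hp hq hpq

theorem near_refl (a : ℤ × ℤ) : Near a a := by
  simp [Near]

/-- The part of an arm that leads from the exit `p` through `s` to the cells of `A`. -/
def arm (L : PlanarLattice) (p s : L.Site) (A : Set (ℤ × ℤ)) : Set L.Site :=
  {p, s} ∪ L.cellSites A

theorem ExitStep.joined_arm {N : ℤ} {p s : L.Site} {c : ℤ × ℤ} (h : ExitStep L N p s c)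
    {A : Set (ℤ × ℤ)} (hc : c ∈ A) {y : L.Site} (hy : cellGraph.Joined A c y.1) :
    L.graph.Joined (L.arm p s A) p y := by
  obtain ⟨x, rfl, hsx⟩ := h.adj_cell
  have h1 : L.graph.Joined (L.arm p s A) p s := by
    rcases h.step with h | h
    · rw [h]
    · exact SimpleGraph.Joined.of_adj h (by simp [arm]) (by simp [arm])
  exact (h1.trans (SimpleGraph.Joined.of_adj hsx (by simp [arm]) (Or.inr hc))).trans
    ((joined_cellSites hc hy).mono Set.subset_union_right)

theorem ExitStep.notMem_box_of_arm {N : ℤ} {p s : L.Site} {c : ℤ × ℤ} (h : ExitStep L N p s c)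
    (hp : L.IsExit N p) {A : Set (ℤ × ℤ)} (hA : ∀ a ∈ A, a ∈ cellBox (N + 2) → a = c) :
    ∀ x ∈ L.arm p s A, x ∉ L.siteBox N := by
  rintro x ((rfl | rfl) | hx) hxN
  · exact hp.1 hxN
  · exact h.notMem hxN
  · have := hA _ hx (siteBox_mono (L := L) (by omega) hxN)
    exact h.cell_notMem (this ▸ siteBox_mono (L := L) (by omega) hxN)

theorem ExitStep.eq_of_adj_arm {N : ℤ} {p s : L.Site} {c : ℤ × ℤ} (h : ExitStep L N p s c)
    {A : Set (ℤ × ℤ)} (hA : ∀ a ∈ A, a ∈ cellBox (N + 2) → a = c) :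
    ∀ x ∈ L.arm p s A, ∀ f ∈ L.siteBox N, L.graph.Adj x f → x = p := by
  rintro x ((rfl | rfl) | hx) f hf hxf
  · rfl
  · exact h.eq_of_adj f hf hxf
  · have h1 := mem_siteBox_add_one_of_adj hf hxf.symm
    have := hA _ hx (siteBox_mono (L := L) (by omega) h1)
    exact absurd (this ▸ h1) h.cell_notMem

theorem ExitStep.subset_box {N : ℤ} {p s : L.Site} {c : ℤ × ℤ} (h : ExitStep L N p s c)
    (hp : L.IsExit N p) {x : L.Site} (hx : x = p ∨ x = s) : x ∈ L.siteBox (N + 1) := by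
  rcases hx with rfl | rfl
  · exact hp.mem
  · exact h.mem

/-- Sites just outside the box do not touch a set of cells outside that avoids their neighbours on
the next layer. -/
theorem not_touch_cellSites {N : ℤ} {x : L.Site} (hx : x ∈ L.siteBox (N + 1)) {B : Set (ℤ × ℤ)}
    {d : ℤ × ℤ} (hB : ∀ b ∈ B, b ∈ cellBox (N + 2) → b = d) (hd : ¬ Near x.1 d) :
    ∀ y ∈ L.cellSites B, x ≠ y ∧ ¬ L.graph.Adj x y := by
  intro y hy
  constructor
  · rintro rfl
    exact hd (hB _ hy (siteBox_mono (L := L) (by omega) hx) ▸ near_refl _)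
  · intro hxy
    have := mem_siteBox_add_one_of_adj hx hxy
    rw [show N + 1 + 1 = N + 2 by ring] at this
    exact hd (hB _ hy this ▸ near_of_adj hxy)

theorem exists_routing {N : ℤ} (hN : 0 ≤ N) {p q : L.Site} (hp : L.IsExit N p)
    (hq : L.IsExit N q) (hpq : p ≠ q) (hadj : ¬ L.graph.Adj p q) : Nonempty (Routing L N p q) := by
  obtain ⟨s, c, s', d, hc, hd, hsep⟩ := exists_exitSteps hN hp hq hpq hadj
  -- Taking `M = N + 2` reserves layer `N + 1` for the exits and the sites `s`, `s'`; the arms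
  -- continue from the boundary cells `c` and `d`.
  obtain ⟨A, B, w, e, T, hAf, hBf, hcA, hdB, hcw, hde, hAB, hAM, hBM, hT, hk⟩ :=
    exists_cellRouting (M := N + 2) (by omega) hc.cell_mem
      (by rw [show N + 2 - 1 = N + 1 by ring]; exact hc.cell_notMem) hd.cell_mem
      (by rw [show N + 2 - 1 = N + 1 by ring]; exact hd.cell_notMem) hsep.not_near
  have hwA : w ∈ A := hcw.mem hcA
  have heB : e ∈ B := hde.mem hdB
  -- The contact of the cells `e` and `T + w` is realised by a single edge of the lattice, whose
  -- ends serve as the exit and the translated entry.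
  obtain ⟨x, y, rfl, hy, hxy, huniq⟩ := exists_unique_edge (L := L) hT
  set z : L.Site := L.translate (-T) y with hz
  have hyz : y = L.translate T z := by simp [hz]
  have hzw : z.1 = w := by
    rw [hz, translate_fst, hy]
    abel
  subst hzw
  have hNear : ∀ a b, Near a b → Near b a := fun a b h => by
    simp only [Near] at h ⊢
    omega
  have htouch : ∀ a ∈ L.arm p s A, ∀ b ∈ L.arm q s' B, a ≠ b ∧ ¬ L.graph.Adj a b := by
    rintro a (ha | ha) b (hb | hb)
    · exact hsep.ne a ha b hb
    · exact not_touch_cellSites (hc.subset_box hp ha) hBM (hsep.not_near_right a ha) b hb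
    · have := not_touch_cellSites (hd.subset_box hq hb) hAM
        (fun h => hsep.not_near_left b hb (hNear _ _ h)) a ha
      exact ⟨this.1.symm, fun h => this.2 h.symm⟩
    · exact ⟨fun h => hAB _ ha _ hb (h ▸ near_refl _), fun h => hAB _ ha _ hb (near_of_adj h)⟩
  have hbox : ∀ a ∈ L.siteBox (N + 1), a ∈ L.cellSites (cellBox (N + 2) ∪ A ∪ B) := fun a ha =>
    Or.inl (Or.inl (siteBox_mono (L := L) (by omega) ha))
  have h0 : ¬ IsStep 0 := by simp [IsStep, Prod.ext_iff]
  exact ⟨{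
    link := {
      carrier := L.cellSites (cellBox (N + 2) ∪ A ∪ B)
      finite := finite_cellSites (((finite_cellBox _).union hAf).union hBf)
      entry := z
      exit := x
      step := T
      entry_mem := Or.inl (Or.inr hwA)
      exit_mem := Or.inr heB
      adj := hyz ▸ hxy
      -- A common site would place the touching cells `e` and `T + w` on top of each other, although
      -- they differ by a unit step.
      ne_of_mem := fun k hk0 a ha b hb hab => by
        have hab' : a.1 = k • T + b.1 := congrArg Prod.fst hab
        rcases hk k hk0 a.1 ha b.1 hb (hab' ▸ near_refl _) with ⟨rfl, h1, h2⟩ | ⟨rfl, h1, h2⟩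
        · refine h0 ?_
          rw [one_smul, h1, h2] at hab'
          rwa [← hab', sub_self] at hT
        · refine h0 ?_
          rw [neg_smul, one_smul, h1, h2] at hab'
          rwa [hab', add_neg_cancel_left, sub_self] at hT
      eq_of_adj := fun k hk0 a ha b hb hab => by
        rcases hk k hk0 a.1 ha b.1 hb (near_of_adj hab) with ⟨rfl, h1, h2⟩ | ⟨rfl, h1, h2⟩
        · rw [one_smul] at hab
          obtain ⟨h3, h4⟩ := huniq a (L.translate T b) h1 (by rw [translate_fst, h2]) hab
          exact Or.inl ⟨rfl, h3, translate_injective T (h4.trans hyz)⟩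
        · rw [neg_smul, one_smul, ← translate_adj_left] at hab
          obtain ⟨h3, h4⟩ := huniq b (L.translate T a) h2 (by rw [translate_fst, h1]) hab.symm
          exact Or.inr ⟨rfl, translate_injective T (h4.trans hyz), h3⟩ }
    armP := L.arm p s A
    armQ := L.arm q s' B
    box_subset := fun a ha => hbox a (siteBox_mono (by omega) ha)
    armP_subset := fun a ha => ha.elim (fun h => hbox a (hc.subset_box hp h))
      fun h => Or.inl (Or.inr h)
    armQ_subset := fun a ha => ha.elim (fun h => hbox a (hd.subset_box hq h)) fun h => Or.inr h
    mem_armP := by simp [arm]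
    mem_armQ := by simp [arm]
    joined_armP := hc.joined_arm hcA hcw
    joined_armQ := hd.joined_arm hdB hde
    notMem_box_of_armP := hc.notMem_box_of_arm hp hAM
    notMem_box_of_armQ := hd.notMem_box_of_arm hq hBM
    ne := fun a ha b hb => (htouch a ha b hb).1
    not_adj := fun a ha b hb => (htouch a ha b hb).2
    eq_of_adj_armP := hc.eq_of_adj_arm hAM
    eq_of_adj_armQ := hd.eq_of_adj_arm hBM }⟩

end PlanarLattice

/-! ### The equivalence -/

open PlanarLattice

namespace Enhancement

variable {L : PlanarLattice} {φ : Enhancement L}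

theorem essential_and_canCreate_of_hasGadget {N : ℤ} (h0 : 0 ≤ N) (hN : φ.RangeIn N)
    (h : φ.HasGadget N) : φ.Essential ∧ φ.CanCreateInfiniteCluster := by
  obtain ⟨i, ζ, p, q, hζ, hp, hq, hpq, hadj, h1, h2⟩ := h
  obtain ⟨r⟩ := exists_routing h0 hp hq hpq hadj
  exact essential_and_canCreate_of_routing hN hζ r h1 h2

theorem essential_iff_canCreate (hφ : φ.Monotonic) :
    φ.Essential ↔ φ.CanCreateInfiniteCluster := by
  obtain ⟨N, hN⟩ := φ.exists_rangeIn
  have h0 : (0 : ℤ) ≤ N := by positivity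
  exact ⟨fun h => (essential_and_canCreate_of_hasGadget h0 hN (hasGadget_of_essential hN h)).2,
    fun h => (essential_and_canCreate_of_hasGadget h0 hN (hasGadget_of_canCreate hφ hN h)).1⟩

end Enhancement

theorem mainTheorem5 (L : PlanarLattice) (φ : Enhancement L) (hφ : φ.Monotonic) :
    (φ.Essential ↔ φ.CanCreateInfiniteCluster) ∧
    (¬ φ.Essential → ∀ (ω : L.Config) (α : L.Site → Bool),
      ¬ L.HasInfiniteCluster ω → ¬ L.HasInfiniteCluster (φ.enhanced ω α)) :=
  ⟨Enhancement.essential_iff_canCreate hφ, fun h ω α hω hα =>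
    h ((Enhancement.essential_iff_canCreate hφ).2 ⟨ω, hω, α, hα⟩)⟩
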